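/- A gauged measure space (gm-space) is a triple $\mathbb X=(X,g,\xi)$ of a Polish space $X$, a Borel probability measure $\xi$ on $X$ and a symmetric function $g\in L^2(X\times X,\xi\otimes\xi)$. For gm-spaces $\mathbb X=(X,g,\xi)$ and $\mathbb Y=(Y,h,\upsilon)$ let $\Pi(\mathbb X,\mathbb Y)$ be the set of Borel probability measures on $X\times Y$ with marginals $\xi$ and $\upsilon$, let $$\mathrm{GW}(\mathbb X,\mathbb Y)=\inf_{\pi\in\Pi(\mathbb X,\mathbb Y)}\Bigl(\iint |g(x,x')-h(y,y')|^2\,d\pi(x,y)\,d\pi(x',y')\Bigr)^{1/2},$$ and let $\Pi_{\mathrm o}(\mathbb X,\mathbb Y)$ be the set of plans that attain this infimum. Let $\mathfrak{GM}$ be the set of classes $[\![\mathbb X]\!]$ of gm-spaces modulo $\mathrm{GW}(\mathbb X,\mathbb Y)=0$, equipped with the metric induced by $\mathrm{GW}$. Fix $\mathfrak X_1,\dots,\mathfrak X_N\in\mathfrak{GM}$ and weights $\rho\in\Delta_{N-1}=\{\rho\in[0,1]^N:\sum_{i}\rho_i=1\}$. For $\mathfrak Y\in\mathfrak{GM}$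 let $\widetilde{\mathrm{TB}}_\rho(\mathfrak Y)\subset\mathfrak{GM}$ be the set of all classes $$\Bigl[\!\Bigl[\bigl(X_1\times\dots\times X_N,\ m_\rho,\ (P_{X_1\times\dots\times X_N})_\#\gamma\bigr)\Bigr]\!\Bigr],\qquad m_\rho(x,x')=\sum_{i=1}^N\rho_i\,g_i(x_i,x_i'),$$ where $\mathbb X_i=(X_i,g_i,\xi_i)\in\mathfrak X_i$ and $\mathbb Y=(Y,h,\upsilon)\in\mathfrak Y$ are representatives and $\gamma$ is a Borel probability measure on $Y\times X_1\times\dots\times X_N$ with $(P_{Y\times X_i})_\#\gamma\in\Pi_{\mathrm o}(\mathbb Y,\mathbb X_i)$ for all $i=1,\dots,N$. Theorem. Let $(\mathfrak Y_n)_{n\in\mathbb N}$ be a sequence in $\mathfrak{GM}$ with $\mathfrak Y_{n+1}\in\widetilde{\mathrm{TB}}_\rho(\mathfrak Y_n)$ for all $n$. Then every subsequence of $(\mathfrak Y_n)$ has a further subsequence that converges in $(\mathfrak{GM},\mathrm{GW})$ to some $\mathfrak Y\in\mathfrak{GM}$ with $\mathfrak Y\in\widetilde{\mathrm{TB}}_\rho(\mathfrak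 Y)$. -/

import Mathlib

open MeasureTheory ProbabilityTheory Filter Topology

universe u

noncomputable section

/-- A gauged measure space `(X, g, ξ)`: a Polish space `X` with its Borel `σ`-algebra, a Borel
probability measure `ξ` and a symmetric gauge `g` that is square integrable with respect to
`ξ ⊗ ξ`. -/
structure GMSpace : Type (u + 1) where
  carrier : Type u
  [top : TopologicalSpace carrier]
  [polish : PolishSpace carrier]
  [meas : MeasurableSpace carrier]
  [borel : BorelSpace carrier]
  ξ : Measure carrier
  [prob : IsProbabilityMeasure ξ]
  g : carrier → carrier → ℝ
  symm : ∀ x x', g x x' = g x' x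
  memLp : MemLp (fun p : carrier × carrier => g p.1 p.2) 2 (ξ.prod ξ)

namespace GMSpace

attribute [instance] top polish meas borel prob

/-- The transport plans `Π(𝕏, 𝕐)`. -/
def plans (X Y : GMSpace.{u}) : Set (Measure (X.carrier × Y.carrier)) :=
  {π | IsProbabilityMeasure π ∧ π.map Prod.fst = X.ξ ∧ π.map Prod.snd = Y.ξ}

/-- The GW functional `‖g(x,x') - h(y,y')‖` in `L²(π(x,y) ⊗ π(x',y'))`. -/
def gwFun (X Y : GMSpace.{u}) (π : Measure (X.carrier × Y.carrier)) : ℝ :=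
  (eLpNorm (fun p : (X.carrier × Y.carrier) × (X.carrier × Y.carrier) =>
    X.g p.1.1 p.2.1 - Y.g p.1.2 p.2.2) 2 (π.prod π)).toReal

/-- The Gromov--Wasserstein distance `GW₂`. -/
def gw (X Y : GMSpace.{u}) : ℝ := sInf (gwFun X Y '' plans X Y)

/-- The optimal transport plans `Π_o(𝕏, 𝕐)`. -/
def optPlans (X Y : GMSpace.{u}) : Set (Measure (X.carrier × Y.carrier)) :=
  {π | π ∈ plans X Y ∧ gwFun X Y π = gw X Y}

/-! ### `gw` is a pseudometric -/

instance nonempty_carrier (X : GMSpace.{u}) : Nonempty X.carrier := X.ξ.nonempty_of_neZero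

theorem measurePreserving_prodMap {A B : Type*} [MeasurableSpace A] [MeasurableSpace B]
    {α : Measure A} {β : Measure B} [SFinite α] [SFinite β] {f : A → B} (hf : Measurable f)
    (h : α.map f = β) :
    MeasurePreserving (fun p : A × A => (f p.1, f p.2)) (α.prod α) (β.prod β) :=
  (MeasurePreserving.mk hf h).prod (MeasurePreserving.mk hf h)

theorem memLp_pullback (X : GMSpace.{u}) {A : Type*} [MeasurableSpace A] {α : Measure A}
    [SFinite α] {f : A → X.carrier} (hf : Measurable f) (h : α.map f = X.ξ) :
    MemLp (fun p : A × A => X.g (f p.1) (f p.2)) 2 (α.prod α) :=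
  X.memLp.comp_measurePreserving (measurePreserving_prodMap hf h)

theorem gwFun_map (X Y : GMSpace.{u}) {A : Type*} [MeasurableSpace A] {α : Measure A}
    [IsProbabilityMeasure α] {f : A → X.carrier} {k : A → Y.carrier} (hf : Measurable f)
    (hk : Measurable k) (h : α.map f = X.ξ) (h' : α.map k = Y.ξ) :
    α.map (fun a => (f a, k a)) ∈ plans X Y ∧
    gwFun X Y (α.map fun a => (f a, k a)) =
      (eLpNorm (fun p : A × A => X.g (f p.1) (f p.2) - Y.g (k p.1) (k p.2)) 2
        (α.prod α)).toReal := by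
  have hm : Measurable fun a => (f a, k a) := hf.prodMk hk
  have := Measure.isProbabilityMeasure_map (μ := α) hm.aemeasurable
  have h1 : (α.map fun a => (f a, k a)).map Prod.fst = X.ξ := by
    rw [Measure.map_map measurable_fst hm]; exact h
  have h2 : (α.map fun a => (f a, k a)).map Prod.snd = Y.ξ := by
    rw [Measure.map_map measurable_snd hm]; exact h'
  refine ⟨⟨this, h1, h2⟩, ?_⟩
  exact congrArg ENNReal.toReal (eLpNorm_comp_measurePreserving
    ((X.memLp_pullback measurable_fst h1).sub
      (Y.memLp_pullback measurable_snd h2)).aestronglyMeasurable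
    (measurePreserving_prodMap hm rfl)).symm

theorem bddBelow_gwFun (X Y : GMSpace.{u}) : BddBelow (gwFun X Y '' plans X Y) :=
  ⟨0, by rintro _ ⟨π, _, rfl⟩; exact ENNReal.toReal_nonneg⟩

theorem nonempty_gwFun (X Y : GMSpace.{u}) : (gwFun X Y '' plans X Y).Nonempty :=
  ⟨_, X.ξ.prod Y.ξ, ⟨inferInstance, by simp, by simp⟩, rfl⟩

theorem gw_le (X Y : GMSpace.{u}) {π : Measure (X.carrier × Y.carrier)} (h : π ∈ plans X Y) :
    gw X Y ≤ gwFun X Y π :=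
  csInf_le (bddBelow_gwFun X Y) ⟨π, h, rfl⟩

theorem gw_nonneg (X Y : GMSpace.{u}) : 0 ≤ gw X Y :=
  Real.sInf_nonneg (by rintro _ ⟨π, _, rfl⟩; exact ENNReal.toReal_nonneg)

theorem gw_self (X : GMSpace.{u}) : gw X X = 0 := by
  obtain ⟨h1, h2⟩ := gwFun_map X X (α := X.ξ) measurable_id measurable_id Measure.map_id
    Measure.map_id
  refine le_antisymm ((gw_le X X h1).trans (le_of_eq ?_)) (gw_nonneg X X)
  rw [h2]
  simp

theorem gw_comm_le (X Y : GMSpace.{u}) : gw X Y ≤ gw Y X := by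
  refine le_csInf (nonempty_gwFun Y X) ?_
  rintro _ ⟨π, ⟨hp, h1, h2⟩, rfl⟩
  obtain ⟨h3, h4⟩ := gwFun_map X Y (α := π) measurable_snd measurable_fst h2 h1
  refine (gw_le X Y h3).trans (le_of_eq ?_)
  rw [h4, gwFun, ← eLpNorm_neg]
  congr 2
  ext p
  simp

/-- Gluing of two plans along their common marginal. -/
theorem exists_gluing (X Y Z : GMSpace.{u}) {π : Measure (X.carrier × Y.carrier)}
    {σ : Measure (Y.carrier × Z.carrier)} (hπ : π ∈ plans X Y) (hσ : σ ∈ plans Y Z) :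
    ∃ γ : Measure ((X.carrier × Y.carrier) × Z.carrier), IsProbabilityMeasure γ ∧
      γ.map Prod.fst = π ∧ γ.map (fun p => (p.1.2, p.2)) = σ := by
  obtain ⟨hp, -, h2⟩ := hπ
  obtain ⟨hs, h3, -⟩ := hσ
  have hm : Measurable fun p : (X.carrier × Y.carrier) × Z.carrier => (p.1.2, p.2) := by
    fun_prop
  refine ⟨π ⊗ₘ (σ.condKernel.comap Prod.snd measurable_snd), inferInstance,
    Measure.fst_compProd _ _, ?_⟩
  ext s hs
  rw [Measure.map_apply hm hs, Measure.compProd_apply (hm hs)]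
  conv_rhs => rw [← σ.disintegrate σ.condKernel, Measure.compProd_apply hs, Measure.fst, h3, ← h2,
    lintegral_map (Kernel.measurable_kernel_prodMk_left hs) measurable_snd]
  rfl

theorem gw_triangle (X Y Z : GMSpace.{u}) : gw X Z ≤ gw X Y + gw Y Z := by
  have key : ∀ π ∈ plans X Y, ∀ σ ∈ plans Y Z, gw X Z ≤ gwFun X Y π + gwFun Y Z σ := by
    intro π hπ σ hσ
    obtain ⟨γ, hγ, h1, h2⟩ := exists_gluing X Y Z hπ hσ
    have mX : Measurable fun p : (X.carrier × Y.carrier) × Z.carrier => p.1.1 := by fun_prop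
    have mY : Measurable fun p : (X.carrier × Y.carrier) × Z.carrier => p.1.2 := by fun_prop
    have mZ : Measurable fun p : (X.carrier × Y.carrier) × Z.carrier => p.2 := by fun_prop
    have eX : γ.map (fun p => p.1.1) = X.ξ := by
      rw [← hπ.2.1, ← h1, Measure.map_map measurable_fst measurable_fst]; rfl
    have eY : γ.map (fun p => p.1.2) = Y.ξ := by
      rw [← hπ.2.2, ← h1, Measure.map_map measurable_snd measurable_fst]; rfl
    have eZ : γ.map (fun p => p.2) = Z.ξ := by
      rw [← hσ.2.2, ← h2, Measure.map_map measurable_snd (mY.prodMk mZ)]; rfl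
    obtain ⟨a1, a2⟩ := gwFun_map X Z mX mZ eX eZ
    have b2 := (gwFun_map X Y mX mY eX eY).2
    have c2 := (gwFun_map Y Z mY mZ eY eZ).2
    have b1 : γ.map (fun p => (p.1.1, p.1.2)) = π := h1
    rw [b1] at b2
    rw [h2] at c2
    have LX := X.memLp_pullback mX eX
    have LY := Y.memLp_pullback mY eY
    have LZ := Z.memLp_pullback mZ eZ
    refine (gw_le X Z a1).trans ?_
    rw [a2, b2, c2]
    refine le_of_le_of_eq ?_
      (ENNReal.toReal_add (LX.sub LY).eLpNorm_ne_top (LY.sub LZ).eLpNorm_ne_top)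
    refine ENNReal.toReal_mono
      (ENNReal.add_ne_top.2 ⟨(LX.sub LY).eLpNorm_ne_top, (LY.sub LZ).eLpNorm_ne_top⟩) ?_
    refine le_trans (le_of_eq ?_) (eLpNorm_add_le (LX.sub LY).aestronglyMeasurable
      (LY.sub LZ).aestronglyMeasurable (by norm_num))
    congr 1
    ext p
    simp
  have h1 : ∀ σ ∈ plans Y Z, gw X Z - gwFun Y Z σ ≤ gw X Y := fun σ hσ =>
    le_csInf (nonempty_gwFun X Y) (by
      rintro _ ⟨π, hπ, rfl⟩
      linarith [key π hπ σ hσ])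
  have h2 : gw X Z - gw X Y ≤ gw Y Z :=
    le_csInf (nonempty_gwFun Y Z) (by
      rintro _ ⟨σ, hσ, rfl⟩
      linarith [h1 σ hσ])
  linarith

instance : PseudoMetricSpace GMSpace.{u} where
  dist := gw
  dist_self := gw_self
  dist_comm X Y := le_antisymm (gw_comm_le X Y) (gw_comm_le Y X)
  dist_triangle := gw_triangle

end GMSpace

/-- The space of homomorphic gm-spaces: gm-spaces modulo `gw 𝕏 𝕐 = 0`, with the metric induced
by `gw`. -/
abbrev GM : Type (u + 1) := SeparationQuotient GMSpace.{u}

/-- The homomorphic equivalence class `⟦𝕏⟧`. -/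
def GMSpace.toGM (X : GMSpace.{u}) : GM.{u} := SeparationQuotient.mk X

theorem GMSpace.toGM_eq_iff (X Y : GMSpace.{u}) : X.toGM = Y.toGM ↔ GMSpace.gw X Y = 0 :=
  SeparationQuotient.mk_eq_mk.trans Metric.inseparable_iff

theorem GMSpace.dist_toGM (X Y : GMSpace.{u}) : dist X.toGM Y.toGM = GMSpace.gw X Y := rfl

namespace GMSpace

variable {N : ℕ}

/-- The multi-marginal transport plans `Π(𝕏₁, …, 𝕏_N)`. -/
def multiPlans (X : Fin N → GMSpace.{u}) : Set (Measure (∀ i, (X i).carrier)) :=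
  {μ | IsProbabilityMeasure μ ∧ ∀ i, μ.map (fun x => x i) = (X i).ξ}

/-- The multi-marginal gluings `Γ_𝕐(π₁, …, π_N)` along `𝕐`. -/
def gluings (Y : GMSpace.{u}) (X : Fin N → GMSpace.{u})
    (π : ∀ i, Measure (Y.carrier × (X i).carrier)) :
    Set (Measure (Y.carrier × ∀ i, (X i).carrier)) :=
  {γ | IsProbabilityMeasure γ ∧ ∀ i, γ.map (fun p => (p.1, p.2 i)) = π i}

/-- The multi-marginal meltings `M_𝕐(π₁, …, π_N)` along `𝕐`. -/
def meltings (Y : GMSpace.{u}) (X : Fin N → GMSpace.{u})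
    (π : ∀ i, Measure (Y.carrier × (X i).carrier)) : Set (Measure (∀ i, (X i).carrier)) :=
  (fun γ => γ.map Prod.snd) '' gluings Y X π

/-- The optimal meltings `M^o_𝕐(𝕏₁, …, 𝕏_N)`. -/
def optMeltings (Y : GMSpace.{u}) (X : Fin N → GMSpace.{u}) :
    Set (Measure (∀ i, (X i).carrier)) :=
  {μ | ∃ π : ∀ i, Measure (Y.carrier × (X i).carrier),
    (∀ i, π i ∈ optPlans Y (X i)) ∧ μ ∈ meltings Y X π}

theorem optMeltings_subset (Y : GMSpace.{u}) (X : Fin N → GMSpace.{u}) :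
    optMeltings Y X ⊆ multiPlans X := by
  rintro _ ⟨π, hπ, γ, ⟨hγ, h⟩, rfl⟩
  refine ⟨Measure.isProbabilityMeasure_map measurable_snd.aemeasurable, fun i => ?_⟩
  have hm : Measurable fun p : Y.carrier × (∀ i, (X i).carrier) => (p.1, p.2 i) := by fun_prop
  rw [← (hπ i).1.2.2, ← h i, Measure.map_map measurable_snd hm]
  exact Measure.map_map (measurable_pi_apply i) measurable_snd

/-- The gm-space `(X_×, m_ρ, μ)` over the product `X_×` of the domains, with the mean gauge
`m_ρ(x, x') = ∑ i, ρ i * g i (x i) (x' i)` and `μ ∈ Π(𝕏₁, …, 𝕏_N)`. -/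
def meanSpace (X : Fin N → GMSpace.{u}) (ρ : Fin N → ℝ) (μ : Measure (∀ i, (X i).carrier))
    (hμ : μ ∈ multiPlans X) : GMSpace.{u} :=
  haveI := hμ.1
  { carrier := ∀ i, (X i).carrier
    ξ := μ
    g := fun x x' => ∑ i, ρ i * (X i).g (x i) (x' i)
    symm := fun x x' => Finset.sum_congr rfl fun i _ => by rw [(X i).symm]
    memLp := memLp_finsetSum _ fun i _ =>
      ((X i).memLp_pullback (measurable_pi_apply i) (hμ.2 i)).const_mul (ρ i) }

end GMSpace

/-- The relaxed tangential barycenter map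
`T̃B_ρ(𝔜) = {⟦(X_×, m_ρ, μ)⟧ : μ ∈ M^o_𝔜(𝕏₁, …, 𝕏_N)}` with respect to `𝔛₁, …, 𝔛_N`,
where `𝕐` and `𝕏ᵢ` range over the representatives of `𝔜` and `𝔛ᵢ`. -/
def relaxedTB {N : ℕ} (ρ : Fin N → ℝ) (𝔛 : Fin N → GM.{u}) (𝔜 : GM.{u}) : Set GM.{u} :=
  {ℨ | ∃ (X : Fin N → GMSpace.{u}) (Y : GMSpace.{u}), (∀ i, (X i).toGM = 𝔛 i) ∧ Y.toGM = 𝔜 ∧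
    ∃ (μ : Measure (∀ i, (X i).carrier)) (hμ : μ ∈ GMSpace.optMeltings Y X),
      ℨ = (GMSpace.meanSpace X ρ μ (GMSpace.optMeltings_subset Y X hμ)).toGM}

end

/-! Let B(𝔜) = ∑ ρ_i GW(𝔜, 𝔛_i)². Two facts carry the proof.

Descent (`sq_dist_add_le_of_mem_relaxedTB`): if ℨ is in the relaxed map of 𝔜, then GW(𝔜, ℨ)² + B(ℨ)
≤ B(𝔜). The gluing γ realizes every distance from 𝔜 to 𝔛_i and gives upper bounds for the distances
to ℨ, so the claim is the integral of the variance identity for a weighted mean. Thus B is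
nonincreasing along the iteration and bounded below, and successive distances tend to 0.

Compactness and closed graph (`exists_subseq_tendsto_relaxedTB`): fix representatives Y, X_1, …,
X_N. By `exists_plan_of_mem_relaxedTB`, elements of the map are, up to small errors, mean spaces of
plans with these fixed marginals, and such plans are tight. The gauges are merely measurable, so
weak convergence does not act on them directly. They are approximated in L² by step functions over
finite partitions. Fixed marginals let weak convergence control product cells
(`eventually_measure_pi_le`), and almost equal cell masses give a coupling that rarely changes
cells. Hence mean spaces and gauge distances pass to the limit
(`eventually_exists_coupling_of_tendsto`), and so does optimality.

Compactness then yields a limit of the successors along a subsequence, descent shows that the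
subsequence itself has the same limit, and the closed graph makes this limit a fixed point. -/

/-! ### Step functions on squares are dense in `L²` -/

/-- `f` is a step function on `X × X`: it factors through the square of a finite measurable
partition of `X`. -/
def IsStepKernel {X : Type*} [MeasurableSpace X] (f : X × X → ℝ) : Prop :=
  ∃ (F : Type) (_ : Fintype F) (q : X → F) (G : F → F → ℝ),
    (∀ s, MeasurableSet (q ⁻¹' {s})) ∧ ∀ p, f p = G (q p.1) (q p.2)

/-- The sets which are unions of rectangles of the square of a finite measurable partition. -/
def stepSets (X : Type*) [MeasurableSpace X] : Set (Set (X × X)) :=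
  {A | ∃ (F : Type) (_ : Fintype F) (q : X → F) (T : F → F → Prop),
    (∀ s, MeasurableSet (q ⁻¹' {s})) ∧ ∀ p, p ∈ A ↔ T (q p.1) (q p.2)}

theorem measurableSet_preimage_prodMk_singleton {X F F' : Type*} [MeasurableSpace X] {q : X → F}
    {q' : X → F'} (hq : ∀ s, MeasurableSet (q ⁻¹' {s})) (hq' : ∀ s, MeasurableSet (q' ⁻¹' {s}))
    (s : F × F') : MeasurableSet ((fun x => (q x, q' x)) ⁻¹' {s}) := by
  convert (hq s.1).inter (hq' s.2) using 1
  ext x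
  simp [Prod.ext_iff]

theorem measurable_top_of_preimage_singleton {X F : Type*} [MeasurableSpace X] [Finite F]
    {q : X → F} (hq : ∀ s, MeasurableSet (q ⁻¹' {s})) : @Measurable X F _ ⊤ q := by
  let _ : MeasurableSpace F := ⊤
  exact measurable_to_countable' hq

theorem IsStepKernel.add {X : Type*} [MeasurableSpace X] {f g : X × X → ℝ}
    (hf : IsStepKernel f) (hg : IsStepKernel g) : IsStepKernel (f + g) := by
  obtain ⟨F, _, q, G, hq, hG⟩ := hf
  obtain ⟨F', _, q', G', hq', hG'⟩ := hg
  exact ⟨F × F', inferInstance, fun x => (q x, q' x), fun s t => G s.1 t.1 + G' s.2 t.2,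
    measurableSet_preimage_prodMk_singleton hq hq', fun p => by simp [hG, hG']⟩

theorem IsStepKernel.measurable {X : Type*} [MeasurableSpace X] {f : X × X → ℝ}
    (hf : IsStepKernel f) : Measurable f := by
  obtain ⟨F, _, q, G, hq, hG⟩ := hf
  let _ : MeasurableSpace F := ⊤
  have hm : Measurable q := measurable_top_of_preimage_singleton hq
  have : f = (fun s : F × F => G s.1 s.2) ∘ fun p : X × X => (q p.1, q p.2) := funext hG
  rw [this]
  exact (measurable_of_finite _).comp
    ((hm.comp measurable_fst).prodMk (hm.comp measurable_snd))

theorem isSetAlgebra_stepSets (X : Type*) [MeasurableSpace X] : IsSetAlgebra (stepSets X) where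
  empty_mem := ⟨Unit, inferInstance, fun _ => (), fun _ _ => False, fun _ => by simp,
    fun p => by simp⟩
  compl_mem := by
    rintro A ⟨F, _, q, T, hq, hT⟩
    exact ⟨F, inferInstance, q, fun s t => ¬ T s t, hq, fun p => by simp [hT]⟩
  union_mem := by
    rintro A B ⟨F, _, q, T, hq, hT⟩ ⟨F', _, q', T', hq', hT'⟩
    exact ⟨F × F', inferInstance, fun x => (q x, q' x), fun s t => T s.1 t.1 ∨ T' s.2 t.2,
      measurableSet_preimage_prodMk_singleton hq hq', fun p => by simp [hT, hT']⟩

theorem isStepKernel_indicator {X : Type*} [MeasurableSpace X] {A : Set (X × X)}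
    (hA : A ∈ stepSets X) (c : ℝ) : IsStepKernel (A.indicator fun _ => c) := by
  classical
  obtain ⟨F, _, q, T, hq, hT⟩ := hA
  exact ⟨F, inferInstance, q, fun s t => if T s t then c else 0, hq,
    fun p => by simp [Set.indicator_apply, hT]⟩

theorem measurableSet_of_mem_stepSets {X : Type*} [MeasurableSpace X] {A : Set (X × X)}
    (hA : A ∈ stepSets X) : MeasurableSet A := by
  have h := (isStepKernel_indicator hA 1).measurable
  have : A = (A.indicator fun _ => (1 : ℝ)) ⁻¹' {1} := by
    ext p
    by_cases hp : p ∈ A <;> simp [hp]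
  rw [this]
  exact h (measurableSet_singleton _)

theorem generateFrom_stepSets (X : Type*) [MeasurableSpace X] :
    (inferInstance : MeasurableSpace (X × X)) = MeasurableSpace.generateFrom (stepSets X) := by
  apply le_antisymm
  · change Prod.instMeasurableSpace ≤ _
    rw [← generateFrom_prod]
    apply MeasurableSpace.generateFrom_mono
    rintro _ ⟨s, hs, t, ht, rfl⟩
    -- A rectangle uses two different sets, but one partition must serve both coordinates: the four
    -- cells given by membership in `s` and in `t`.
    refine ⟨Prop × Prop, inferInstance, fun x => (x ∈ s, x ∈ t), fun a b => a.1 ∧ b.2,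
      measurableSet_preimage_prodMk_singleton (fun a => ?_) (fun a => ?_), fun p => Iff.rfl⟩
    · exact (measurable_mem.2 hs) (measurableSet_singleton a)
    · exact (measurable_mem.2 ht) (measurableSet_singleton a)
  · exact MeasurableSpace.generateFrom_le fun A hA => measurableSet_of_mem_stepSets hA

/-- The step sets form an algebra generating the product σ-algebra, so they approximate measurable
sets in measure. Indicators are therefore approximable in L², and sums stay step functions over the
common refinement of the partitions. -/
theorem exists_isStepKernel_eLpNorm_sub_le {X : Type*} [MeasurableSpace X]
    {μ : Measure (X × X)} [IsFiniteMeasure μ] {f : X × X → ℝ} (hf : MemLp f 2 μ)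
    {ε : ENNReal} (hε : ε ≠ 0) : ∃ g, eLpNorm (f - g) 2 μ ≤ ε ∧ IsStepKernel g := by
  refine hf.induction_dense (by norm_num) IsStepKernel (fun c s hs _ ε hε => ?_)
    (fun f g => IsStepKernel.add) (fun f h => h.measurable.aestronglyMeasurable) hε
  have hd : μ.MeasureDense (stepSets X) := .of_generateFrom_isSetAlgebra_finite μ
    (isSetAlgebra_stepSets X) (generateFrom_stepSets X)
  obtain ⟨η, η0, hη⟩ := exists_eLpNorm_indicator_le (p := 2) (μ := μ) (by norm_num) c hε
  obtain ⟨t, ht, hst⟩ := hd.approx s hs (measure_ne_top _ _) η (by exact_mod_cast η0)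
  refine ⟨t.indicator fun _ => c, ?_, isStepKernel_indicator ht c⟩
  have := hη (symmDiff s t) (by simpa using hst.le)
  refine le_trans (eLpNorm_mono fun p => ?_) this
  by_cases h1 : p ∈ s <;> by_cases h2 : p ∈ t <;> simp [h1, h2, Set.mem_symmDiff]

/-! ### Couplings close to the diagonal -/

/-- Two probability vectors admit a coupling whose off-diagonal mass is their total variation. -/
theorem exists_coupling_matrix {F : Type*} [Fintype F] [DecidableEq F] {a b : F → ℝ}
    (ha : ∀ s, 0 ≤ a s) (hb : ∀ s, 0 ≤ b s) (hab : ∑ s, a s = ∑ s, b s) {δ : ℝ}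
    (hδ : ∀ s, b s ≤ a s + δ) (hδ0 : 0 ≤ δ) :
    ∃ W : F → F → ℝ, (∀ s t, 0 ≤ W s t) ∧ (∀ s, ∑ t, W s t = a s) ∧ (∀ t, ∑ s, W s t = b t) ∧
      ∑ s, ∑ t, (if s = t then 0 else W s t) ≤ Fintype.card F * δ := by
  -- The common part `w` stays on the diagonal. The two remainders have the same total mass `r` and
  -- are coupled independently.
  set w : F → ℝ := fun s => min (a s) (b s)
  set r : ℝ := ∑ s, (b s - w s)
  have har : ∑ s, (a s - w s) = r := by simp [r, Finset.sum_sub_distrib, hab]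
  have haw : ∀ s, 0 ≤ a s - w s := fun s => sub_nonneg.2 (min_le_left _ _)
  have hbw : ∀ s, 0 ≤ b s - w s := fun s => sub_nonneg.2 (min_le_right _ _)
  have hw : ∀ s, 0 ≤ w s := fun s => le_min (ha s) (hb s)
  have hr : 0 ≤ r := Finset.sum_nonneg fun s _ => hbw s
  have hrδ : r ≤ Fintype.card F * δ := by
    calc r ≤ ∑ _s : F, δ := Finset.sum_le_sum fun s _ => by
          have := hδ s
          rcases min_choice (a s) (b s) with h | h <;> simp only [w, h] <;> linarith
      _ = _ := by simp
  -- Covers `r = 0`, where division returns 0: both remainders then vanish.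
  have cancel : ∀ c : ℝ, (r = 0 → c = 0) → c * r / r = c := fun c hc => by
    rcases eq_or_ne r 0 with h | h
    · simp [h, hc h]
    · field_simp
  refine ⟨fun s t => (if s = t then w s else 0) + (a s - w s) * (b t - w t) / r,
    fun s t => ?_, fun s => ?_, fun t => ?_, ?_⟩
  · have := div_nonneg (mul_nonneg (haw s) (hbw t)) hr
    have h' := hw s
    dsimp only
    split_ifs <;> linarith
  · rw [Finset.sum_add_distrib, ← Finset.sum_div, ← Finset.mul_sum]
    change _ + _ * r / r = _
    rw [cancel _ fun h => ?_]
    · simp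
    · exact (Finset.sum_eq_zero_iff_of_nonneg fun s _ => haw s).1 (har.trans h) s
        (Finset.mem_univ s)
  · rw [Finset.sum_add_distrib, ← Finset.sum_div, ← Finset.sum_mul, har, mul_comm r]
    rw [cancel _ fun h => ?_]
    · simp
    · exact (Finset.sum_eq_zero_iff_of_nonneg fun s _ => hbw s).1 h t (Finset.mem_univ t)
  · refine le_trans (Finset.sum_le_sum fun s _ => Finset.sum_le_sum fun t _ =>
      (?_ : _ ≤ (a s - w s) * (b t - w t) / r)) (le_trans (le_of_eq ?_) hrδ)
    · have := div_nonneg (mul_nonneg (haw s) (hbw t)) hr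
      split_ifs with h
      · exact this
      · simp [h]
    · simp_rw [← Finset.sum_div, ← Finset.mul_sum]
      change (∑ s, (a s - w s) * r) / r = r
      rw [← Finset.sum_mul, har, cancel _ id]

theorem measure_eq_sum_restrict_fibers {Ω F : Type*} [MeasurableSpace Ω] [Fintype F] {q : Ω → F}
    (hq : ∀ s, MeasurableSet (q ⁻¹' {s})) (α : Measure Ω) :
    ∑ s, α.restrict (q ⁻¹' {s}) = α := by
  ext A hA
  simp_rw [Measure.finsetSum_apply, Measure.restrict_apply' (hq _)]
  have := sum_measure_preimage_singleton (μ := α.restrict A) (f := q) Finset.univ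
    fun s _ => hq s
  simp_rw [Measure.restrict_apply (hq _)] at this
  simpa [Set.inter_comm] using this

theorem map_finsetSum_measure {A B I : Type*} [MeasurableSpace A] [MeasurableSpace B] {f : A → B}
    (hf : Measurable f) (s : Finset I) (m : I → Measure A) :
    (∑ i ∈ s, m i).map f = ∑ i ∈ s, (m i).map f := by
  simp_rw [← Measure.mapₗ_apply_of_measurable hf, map_sum]

/-- Two probability measures which give almost the same mass to the cells of a finite partition
admit a coupling for which the two coordinates rarely lie in different cells. -/
theorem exists_coupling_of_fibers {Ω F : Type*} [MeasurableSpace Ω] [Fintype F]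
    {q : Ω → F} (hq : ∀ s, MeasurableSet (q ⁻¹' {s})) (α β : Measure Ω) [IsProbabilityMeasure α]
    [IsProbabilityMeasure β] {δ : ℝ} (hδ0 : 0 ≤ δ)
    (hδ : ∀ s, β.real (q ⁻¹' {s}) ≤ α.real (q ⁻¹' {s}) + δ) :
    ∃ π : Measure (Ω × Ω), IsProbabilityMeasure π ∧ π.map Prod.fst = α ∧ π.map Prod.snd = β ∧
      π {p | q p.1 ≠ q p.2} ≤ ENNReal.ofReal (Fintype.card F * δ) := by
  classical
  have total : ∀ (ν : Measure Ω) [IsProbabilityMeasure ν], ∑ s, ν.real (q ⁻¹' {s}) = 1 := by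
    intro ν _
    have := sum_measureReal_preimage_singleton (μ := ν) (f := q) Finset.univ fun s _ => hq s
    simpa using this
  obtain ⟨W, hW0, hWa, hWb, hW⟩ := exists_coupling_matrix
    (a := fun s => α.real (q ⁻¹' {s})) (b := fun s => β.real (q ⁻¹' {s}))
    (fun _ => measureReal_nonneg) (fun _ => measureReal_nonneg)
    ((total α).trans (total β).symm) hδ hδ0
  have hWle : ∀ s t, W s t ≤ α.real (q ⁻¹' {s}) ∧ W s t ≤ β.real (q ⁻¹' {t}) := fun s t =>
    ⟨(Finset.single_le_sum (fun t _ => hW0 s t) (Finset.mem_univ t)).trans_eq (hWa s),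
      (Finset.single_le_sum (f := fun s => W s t) (fun s _ => hW0 s t)
        (Finset.mem_univ s)).trans_eq (hWb t)⟩
  have hWα : ∀ s, ∑ t, ENNReal.ofReal (W s t) = α (q ⁻¹' {s}) := fun s => by
    rw [← ENNReal.ofReal_sum_of_nonneg fun t _ => hW0 s t, hWa, ofReal_measureReal]
  have hWβ : ∀ t, ∑ s, ENNReal.ofReal (W s t) = β (q ⁻¹' {t}) := fun t => by
    rw [← ENNReal.ofReal_sum_of_nonneg fun s _ => hW0 s t, hWb, ofReal_measureReal]
  -- On a null cell the inverse is `⊤`, but `W s t` is bounded by the cell mass and vanishes, so the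
  -- product is still correct.
  have hcβ : ∀ s t, ENNReal.ofReal (W s t) * (β (q ⁻¹' {t}))⁻¹ * β (q ⁻¹' {t}) =
      ENNReal.ofReal (W s t) := fun s t => by
    rcases eq_or_ne (β (q ⁻¹' {t})) 0 with h | h
    · have : W s t ≤ 0 := by simpa [Measure.real, h] using (hWle s t).2
      simp [ENNReal.ofReal_eq_zero.2 this]
    · rw [mul_assoc, ENNReal.inv_mul_cancel h (measure_ne_top _ _), mul_one]
  have hcα : ∀ s t, ENNReal.ofReal (W s t) * (α (q ⁻¹' {s}))⁻¹ * α (q ⁻¹' {s}) =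
      ENNReal.ofReal (W s t) := fun s t => by
    rcases eq_or_ne (α (q ⁻¹' {s})) 0 with h | h
    · have : W s t ≤ 0 := by simpa [Measure.real, h] using (hWle s t).1
      simp [ENNReal.ofReal_eq_zero.2 this]
    · rw [mul_assoc, ENNReal.inv_mul_cancel h (measure_ne_top _ _), mul_one]
  have normalize : ∀ (ν : Measure Ω) [IsProbabilityMeasure ν],
      ∑ s, (ν (q ⁻¹' {s}) * (ν (q ⁻¹' {s}))⁻¹) • ν.restrict (q ⁻¹' {s}) = ν := by
    intro ν _
    conv_rhs => rw [← measure_eq_sum_restrict_fibers hq ν]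
    refine Finset.sum_congr rfl fun s _ => ?_
    rcases eq_or_ne (ν (q ⁻¹' {s})) 0 with h | h
    · simp [Measure.restrict_eq_zero.2 h]
    · rw [ENNReal.mul_inv_cancel h (measure_ne_top _ _), one_smul]
  -- Mass `W s t` is spread over the cell pair as the product of the normalized restrictions of `α`
  -- and `β`.
  set c : F → F → ENNReal := fun s t =>
    ENNReal.ofReal (W s t) * (α (q ⁻¹' {s}))⁻¹ * (β (q ⁻¹' {t}))⁻¹
  set π : Measure (Ω × Ω) := ∑ s, ∑ t, c s t •
    (α.restrict (q ⁻¹' {s})).prod (β.restrict (q ⁻¹' {t}))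
  have h1 : π.map Prod.fst = α := by
    conv_rhs => rw [← normalize α]
    simp only [π, map_finsetSum_measure measurable_fst, Measure.map_smul,
      Measure.map_fst_prod, Measure.restrict_apply_univ, smul_smul]
    refine Finset.sum_congr rfl fun s _ => ?_
    rw [← Finset.sum_smul]
    congr 1
    calc _ = ∑ t, ENNReal.ofReal (W s t) * (α (q ⁻¹' {s}))⁻¹ := Finset.sum_congr rfl fun t _ => by
          conv_rhs => rw [← hcβ s t]
          simp only [c]
          ring
      _ = _ := by rw [← Finset.sum_mul, hWα s]
  have h2 : π.map Prod.snd = β := by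
    conv_rhs => rw [← normalize β]
    simp only [π, map_finsetSum_measure measurable_snd, Measure.map_smul,
      Measure.map_snd_prod, Measure.restrict_apply_univ, smul_smul]
    rw [Finset.sum_comm]
    refine Finset.sum_congr rfl fun t _ => ?_
    rw [← Finset.sum_smul]
    congr 1
    calc _ = ∑ s, ENNReal.ofReal (W s t) * (β (q ⁻¹' {t}))⁻¹ := Finset.sum_congr rfl fun s _ => by
          conv_rhs => rw [← hcα s t]
          simp only [c]
          ring
      _ = _ := by rw [← Finset.sum_mul, hWβ t]
  have hπ : IsProbabilityMeasure π := by
    have : IsProbabilityMeasure (π.map Prod.fst) := h1 ▸ inferInstance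
    exact (Measure.isProbabilityMeasure_map_iff measurable_fst.aemeasurable).1 this
  refine ⟨π, hπ, h1, h2, ?_⟩
  refine le_trans ?_ (ENNReal.ofReal_le_ofReal hW)
  rw [ENNReal.ofReal_sum_of_nonneg fun s _ => Finset.sum_nonneg fun t _ => by
    split_ifs <;> [exact le_rfl; exact hW0 s t]]
  simp only [π, Measure.finsetSum_apply, Measure.smul_apply, smul_eq_mul]
  refine Finset.sum_le_sum fun s _ => ?_
  rw [ENNReal.ofReal_sum_of_nonneg fun t _ => by
    split_ifs <;> [exact le_rfl; exact hW0 s t]]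
  refine Finset.sum_le_sum fun t _ => ?_
  split_ifs with h
  · rw [Measure.prod_restrict, Measure.restrict_apply' ((hq s).prod (hq t))]
    have : {p : Ω × Ω | q p.1 ≠ q p.2} ∩ (q ⁻¹' {s}) ×ˢ (q ⁻¹' {t}) = ∅ := by
      ext p
      simp only [Set.mem_inter_iff, Set.mem_ofPred_eq, Set.mem_prod, Set.mem_preimage,
        Set.mem_singleton_iff, Set.mem_empty_iff_false, iff_false]
      rintro ⟨h1, h2, h3⟩
      exact h1 (h2.trans (h.trans h3.symm))
    simp [this]
  · refine (mul_le_mul_right (measure_mono (Set.subset_univ _)) _).trans_eq ?_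
    rw [← Set.univ_prod_univ, Measure.prod_prod, Measure.restrict_apply_univ,
      Measure.restrict_apply_univ]
    calc _ = ENNReal.ofReal (W s t) * (β (q ⁻¹' {t}))⁻¹ * β (q ⁻¹' {t}) *
          (α (q ⁻¹' {s}))⁻¹ * α (q ⁻¹' {s}) := by simp only [c]; ring
      _ = _ := by rw [hcβ, hcα]

/-! ### Gluing families of plans -/

theorem map_prodMk_randomization {A B : Type*} [MeasurableSpace A] [MeasurableSpace B]
    {α : Measure A} [IsProbabilityMeasure α] {κ : Kernel A B} [IsMarkovKernel κ]
    {f : A → unitInterval → B} (hf : Measurable (Function.uncurry f))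
    (h : ∀ a, volume.map (f a) = κ a) :
    (α.prod volume).map (fun p : A × unitInterval => (p.1, f p.1 p.2)) = α ⊗ₘ κ := by
  have hm : Measurable fun p : A × unitInterval => (p.1, f p.1 p.2) := measurable_fst.prodMk hf
  ext s hs
  rw [Measure.map_apply hm hs, Measure.prod_apply (hm hs), Measure.compProd_apply hs]
  refine lintegral_congr fun a => ?_
  rw [← h a, Measure.map_apply hf.of_uncurry_left (measurable_prodMk_left hs)]
  rfl

/-- Each conditional kernel of `τ o` is realized as a function of `x o` and a uniform variable.
Independent uniforms, one per coordinate, drive all kernels at once over `γ`. -/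
theorem exists_gluing_pi {ι : Type*} [Fintype ι] {A B : ι → Type*}
    [∀ o, MeasurableSpace (A o)] [∀ o, MeasurableSpace (B o)] [∀ o, StandardBorelSpace (B o)]
    [∀ o, Nonempty (B o)] (γ : Measure (∀ o, A o)) [IsProbabilityMeasure γ]
    (τ : ∀ o, Measure (A o × B o)) [∀ o, IsProbabilityMeasure (τ o)]
    (hτ : ∀ o, (τ o).map Prod.fst = γ.map fun x => x o) :
    ∃ Γ : Measure ((∀ o, A o) × ∀ o, B o), IsProbabilityMeasure Γ ∧ Γ.map Prod.fst = γ ∧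
      ∀ o, Γ.map (fun p => (p.1 o, p.2 o)) = τ o := by
  choose f hf hfκ using fun o => (τ o).condKernel.exists_measurable_map_eq_unitInterval
  let P : Measure ((∀ o, A o) × (ι → unitInterval)) := γ.prod (Measure.pi fun _ => volume)
  let k : (∀ o, A o) × (ι → unitInterval) → (∀ o, A o) × ∀ o, B o :=
    fun p => (p.1, fun o => f o (p.1 o) (p.2 o))
  have hk : Measurable k := by
    refine measurable_fst.prodMk (measurable_pi_iff.2 fun o => ?_)
    exact (hf o).comp (((measurable_pi_apply o).comp measurable_fst).prodMk
      ((measurable_pi_apply o).comp measurable_snd))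
  refine ⟨P.map k, Measure.isProbabilityMeasure_map hk.aemeasurable, ?_, fun o => ?_⟩
  · rw [Measure.map_map measurable_fst hk]
    exact (Measure.map_fst_prod ..).trans (by simp)
  · have hγo : IsProbabilityMeasure (γ.map fun x => x o) :=
      Measure.isProbabilityMeasure_map (measurable_pi_apply o).aemeasurable
    have ho : Measurable fun p : (∀ o, A o) × ∀ o, B o => (p.1 o, p.2 o) := by fun_prop
    rw [Measure.map_map ho hk]
    have h1 : P.map (fun p => (p.1 o, p.2 o)) =
        (γ.map fun x => x o).prod (volume : Measure unitInterval) := by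
      have e : (Measure.pi fun _ : ι => (volume : Measure unitInterval)).map (fun u => u o) =
          volume := (measurePreserving_eval (fun _ => volume) o).map_eq
      conv_rhs => rw [← e]
      rw [Measure.map_prod_map _ _ (measurable_pi_apply o) (measurable_pi_apply o)]
      rfl
    have h2 : (fun p : (∀ o, A o) × ∀ o, B o => (p.1 o, p.2 o)) ∘ k =
        (fun p : A o × unitInterval => (p.1, f o p.1 p.2)) ∘ fun p => (p.1 o, p.2 o) := rfl
    have hm : Measurable fun p : (∀ o, A o) × (ι → unitInterval) => (p.1 o, p.2 o) := by
      fun_prop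
    have hm' : Measurable fun p : A o × unitInterval => (p.1, f o p.1 p.2) :=
      measurable_fst.prodMk (hf o)
    rw [h2, ← Measure.map_map hm' hm, h1,
      map_prodMk_randomization (hf o) (hfκ o), ← hτ o]
    exact (τ o).disintegrate (τ o).condKernel

/-! ### Weak compactness of multi-marginal plans -/

theorem measure_compl_univ_pi_le {ι : Type*} [Fintype ι] {A : ι → Type*}
    [∀ o, MeasurableSpace (A o)] (γ : Measure (∀ o, A o)) {ξ : ∀ o, Measure (A o)}
    (hγ : ∀ o, γ.map (fun x => x o) = ξ o) {K : ∀ o, Set (A o)} (hK : ∀ o, MeasurableSet (K o)) :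
    γ (Set.univ.pi K)ᶜ ≤ ∑ o, ξ o (K o)ᶜ := by
  have : (Set.univ.pi K)ᶜ = ⋃ o, (fun x : ∀ o, A o => x o) ⁻¹' (K o)ᶜ := by
    ext x
    simp
  rw [this]
  refine (measure_iUnion_fintype_le _ _).trans (Finset.sum_le_sum fun o _ => le_of_eq ?_)
  rw [← hγ o, Measure.map_apply (measurable_pi_apply o) (hK o).compl]

theorem isTightMeasureSet_marginals {ι : Type*} [Fintype ι] {A : ι → Type*}
    [∀ o, TopologicalSpace (A o)] [∀ o, PolishSpace (A o)] [∀ o, MeasurableSpace (A o)]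
    [∀ o, BorelSpace (A o)] (ξ : ∀ o, Measure (A o)) [∀ o, IsProbabilityMeasure (ξ o)] :
    IsTightMeasureSet {γ : Measure (∀ o, A o) | ∀ o, γ.map (fun x => x o) = ξ o} := by
  rw [isTightMeasureSet_iff_exists_isCompact_measure_compl_le]
  intro ε hε
  obtain ⟨δ, δ0, hδ⟩ : ∃ δ : ENNReal, 0 < δ ∧ Fintype.card ι * δ ≤ ε := by
    rcases isEmpty_or_nonempty ι with h | h
    · exact ⟨1, one_pos, by simp⟩
    · exact ⟨ε / Fintype.card ι, ENNReal.div_pos hε.ne' (by simp), ENNReal.mul_div_le⟩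
  have := fun o => isTightMeasureSet_iff_exists_isCompact_measure_compl_le.1
    (isTightMeasureSet_singleton (μ := ξ o)) δ δ0
  choose K hK hKδ using this
  refine ⟨Set.univ.pi K, isCompact_univ_pi hK, fun γ hγ => ?_⟩
  refine (measure_compl_univ_pi_le γ hγ fun o => (hK o).measurableSet).trans ?_
  refine (Finset.sum_le_sum fun o _ => hKδ o _ rfl).trans ?_
  simpa using hδ

/-- The portmanteau inequality covers open boxes. Outer regularity of the fixed marginals extends it
to measurable boxes, since enlarging a side `s o` to `U o` costs at most its marginal excess,
uniformly in `n`. -/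
theorem eventually_measure_pi_le {ι : Type*} [Fintype ι] {A : ι → Type*}
    [∀ o, TopologicalSpace (A o)] [∀ o, PolishSpace (A o)] [∀ o, MeasurableSpace (A o)]
    [∀ o, BorelSpace (A o)] {ξ : ∀ o, Measure (A o)} [∀ o, IsProbabilityMeasure (ξ o)]
    {γ : ℕ → ProbabilityMeasure (∀ o, A o)} {γ' : ProbabilityMeasure (∀ o, A o)}
    (hγ : ∀ n o, (γ n : Measure (∀ o, A o)).map (fun x => x o) = ξ o) (h : Tendsto γ atTop (𝓝 γ'))
    {s : ∀ o, Set (A o)} (hs : ∀ o, MeasurableSet (s o)) {δ : ENNReal} (hδ : δ ≠ 0) :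
    ∀ᶠ n in atTop, (γ' : Measure (∀ o, A o)) (Set.univ.pi s) ≤
      (γ n : Measure (∀ o, A o)) (Set.univ.pi s) + δ := by
  -- One `η` for each enlarged side and one for the liminf.
  obtain ⟨η, η0, hη⟩ : ∃ η : ENNReal, η ≠ 0 ∧ (Fintype.card ι + 1) * η ≤ δ := by
    refine ⟨δ / (Fintype.card ι + 1), (ENNReal.div_pos hδ (by finiteness)).ne',
      ENNReal.mul_div_le⟩
  choose U hsU hU hUη using fun o => (hs o).exists_isOpen_sdiff_lt (μ := ξ o)
    (measure_ne_top _ _) η0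
  have hUo : IsOpen (Set.univ.pi U) := isOpen_set_pi Set.finite_univ fun o _ => hU o
  have hdiff : ∀ n, (γ n : Measure (∀ o, A o)) (Set.univ.pi U) ≤
      (γ n : Measure (∀ o, A o)) (Set.univ.pi s) + Fintype.card ι * η := fun n => by
    have hsub : Set.univ.pi U ⊆ Set.univ.pi s ∪
        ⋃ o, (fun x : ∀ o, A o => x o) ⁻¹' (U o \ s o) := by
      intro x hx
      by_cases hxs : x ∈ Set.univ.pi s
      · exact Or.inl hxs
      · obtain ⟨o, ho⟩ : ∃ o, x o ∉ s o := by simpa using hxs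
        exact Or.inr (Set.mem_iUnion.2 ⟨o, hx o trivial, ho⟩)
    refine (measure_mono hsub).trans ((measure_union_le _ _).trans (add_le_add le_rfl ?_))
    refine (measure_iUnion_fintype_le _ _).trans ?_
    refine (Finset.sum_le_sum (g := fun _ => η) fun o _ => ?_).trans (by simp)
    rw [← Measure.map_apply (measurable_pi_apply o) ((hU o).measurableSet.diff (hs o)), hγ]
    exact (hUη o).2.le
  have hlim := ProbabilityMeasure.le_liminf_measure_open_of_tendsto h hUo
  rcases eq_or_ne ((γ' : Measure (∀ o, A o)) (Set.univ.pi U)) 0 with h0 | h0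
  · exact .of_forall fun n => (measure_mono (Set.pi_mono fun o _ => hsU o)).trans (by simp [h0])
  have hlt := (ENNReal.sub_lt_self (measure_ne_top _ _) h0 η0).trans_le hlim
  filter_upwards [eventually_lt_of_lt_liminf hlt] with n hn
  calc (γ' : Measure (∀ o, A o)) (Set.univ.pi s) ≤ (γ' : Measure (∀ o, A o)) (Set.univ.pi U) :=
        measure_mono (Set.pi_mono fun o _ => hsU o)
    _ ≤ (γ n : Measure (∀ o, A o)) (Set.univ.pi U) + η := tsub_le_iff_right.1 hn.le
    _ ≤ (γ n : Measure (∀ o, A o)) (Set.univ.pi s) + Fintype.card ι * η + η := by gcongr; exact hdiff n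
    _ = (γ n : Measure (∀ o, A o)) (Set.univ.pi s) + (Fintype.card ι + 1) * η := by ring
    _ ≤ _ := by gcongr

/-- Prokhorov's theorem. The marginals survive in the limit because the coordinate maps are
continuous. -/
theorem exists_subseq_tendsto_of_marginals {ι : Type*} [Fintype ι] {A : ι → Type*}
    [∀ o, TopologicalSpace (A o)] [∀ o, PolishSpace (A o)] [∀ o, MeasurableSpace (A o)]
    [∀ o, BorelSpace (A o)] {ξ : ∀ o, Measure (A o)} [∀ o, IsProbabilityMeasure (ξ o)]
    (γ : ℕ → ProbabilityMeasure (∀ o, A o))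
    (hγ : ∀ n o, (γ n : Measure (∀ o, A o)).map (fun x => x o) = ξ o) :
    ∃ γ' : ProbabilityMeasure (∀ o, A o), (∀ o, (γ' : Measure (∀ o, A o)).map (fun x => x o) = ξ o) ∧
      ∃ ψ : ℕ → ℕ, StrictMono ψ ∧ Tendsto (γ ∘ ψ) atTop (𝓝 γ') := by
  have hc : IsCompact (closure (Set.range γ)) := by
    refine isCompact_closure_of_isTightMeasureSet ((isTightMeasureSet_marginals ξ).subset ?_)
    rintro _ ⟨_, ⟨n, rfl⟩, rfl⟩
    exact hγ n
  obtain ⟨γ', -, ψ, hψ, hlim⟩ := hc.tendsto_subseq fun n => subset_closure (Set.mem_range_self n)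
  refine ⟨γ', fun o => ?_, ψ, hψ, hlim⟩
  have hcont := (continuous_apply o : Continuous fun x : ∀ o, A o => x o)
  have h1 := ProbabilityMeasure.tendsto_map_of_tendsto_of_continuous _ _ hlim hcont
  have h2 : (fun n => ((γ ∘ ψ) n).map hcont.measurable.aemeasurable) =
      fun _ => (⟨ξ o, inferInstance⟩ : ProbabilityMeasure (A o)) := by
    ext1 n
    exact Subtype.ext (hγ _ o)
  rw [h2] at h1
  exact congrArg ProbabilityMeasure.toMeasure (tendsto_nhds_unique h1 tendsto_const_nhds)

/-! ### Weak convergence with fixed marginals controls the gauges -/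

/-- The integrand vanishes unless one of the two independent pairs changes cells. This exceptional
set has mass at most `2 * π E`, and there the integrand is at most `2 * C`. -/
theorem eLpNorm_step_sub_le {Ω F : Type*} [MeasurableSpace Ω] {q : Ω → F}
    {G : F → F → ℝ} {C : ℝ} (hG : ∀ s t, |G s t| ≤ C)
    (π : Measure (Ω × Ω)) [IsProbabilityMeasure π] :
    eLpNorm (fun p : (Ω × Ω) × (Ω × Ω) => G (q p.1.1) (q p.2.1) - G (q p.1.2) (q p.2.2)) 2
      (π.prod π) ≤ ENNReal.ofReal (2 * C) * (2 * π {p | q p.1 ≠ q p.2}) ^ (1 / 2 : ℝ) := by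
  set E : Set (Ω × Ω) := {p | q p.1 ≠ q p.2}
  set E' : Set ((Ω × Ω) × (Ω × Ω)) := E ×ˢ Set.univ ∪ Set.univ ×ˢ E
  have hE' : π.prod π E' ≤ 2 * π E := by
    refine (measure_union_le _ _).trans (le_of_eq ?_)
    simp [Measure.prod_prod, two_mul]
  have hmono := eLpNorm_mono (p := 2) (μ := π.prod π)
    (f := fun p : (Ω × Ω) × (Ω × Ω) => G (q p.1.1) (q p.2.1) - G (q p.1.2) (q p.2.2))
    (g := E'.indicator fun _ => (2 * C : ℝ)) fun p => by
      by_cases hp : p ∈ E'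
      · rw [Set.indicator_of_mem hp]
        have h1 := abs_sub (G (q p.1.1) (q p.2.1)) (G (q p.1.2) (q p.2.2))
        have h2 := hG (q p.1.1) (q p.2.1)
        have h3 := hG (q p.1.2) (q p.2.2)
        exact (h1.trans (by linarith)).trans (le_abs_self _)
      · have : q p.1.1 = q p.1.2 ∧ q p.2.1 = q p.2.2 := by
          simpa [E', E, not_or] using hp
        simp [this.1, this.2]
  refine hmono.trans ((eLpNorm_indicator_const_le _ _).trans ?_)
  obtain ⟨⟨x, -⟩⟩ := π.nonempty_of_neZero
  rw [Real.enorm_of_nonneg (by linarith [(abs_nonneg _).trans (hG (q x) (q x))])]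
  gcongr
  simpa using ENNReal.rpow_le_rpow hE' (by norm_num)

namespace GMSpace

variable {ι : Type*} [Fintype ι]

/-- Weakly convergent multi-marginal plans with fixed marginals admit couplings with their limit
along which all gauges become asymptotically equal. -/
theorem eventually_exists_coupling_of_tendsto (Z : ι → GMSpace.{u})
    {γ : ℕ → ProbabilityMeasure (∀ o, (Z o).carrier)}
    {γ' : ProbabilityMeasure (∀ o, (Z o).carrier)}
    (hγ : ∀ n o, (γ n : Measure (∀ o, (Z o).carrier)).map (fun x => x o) = (Z o).ξ)
    (hγ' : ∀ o, (γ' : Measure (∀ o, (Z o).carrier)).map (fun x => x o) = (Z o).ξ)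
    (h : Tendsto γ atTop (𝓝 γ')) {ε : ENNReal} (hε : ε ≠ 0) :
    ∀ᶠ n in atTop, ∃ π : Measure ((∀ o, (Z o).carrier) × ∀ o, (Z o).carrier),
      IsProbabilityMeasure π ∧ π.map Prod.fst = γ n ∧ π.map Prod.snd = γ' ∧
      ∀ o, eLpNorm (fun p : ((∀ o, (Z o).carrier) × ∀ o, (Z o).carrier) ×
        ((∀ o, (Z o).carrier) × ∀ o, (Z o).carrier) =>
          (Z o).g (p.1.1 o) (p.2.1 o) - (Z o).g (p.1.2 o) (p.2.2 o)) 2 (π.prod π) ≤ ε := by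
  classical
  -- Two thirds pay for replacing the gauge by a step function on either side, one third for the
  -- mass that changes cells.
  have h3 : ε / 3 ≠ 0 := (ENNReal.div_pos hε (by norm_num)).ne'
  have hstep := fun o => exists_isStepKernel_eLpNorm_sub_le (Z o).memLp h3
  choose f hfε hf using hstep
  choose F hF q G hq hG using hf
  obtain ⟨C, hC⟩ : ∃ C : ℝ, ∀ o s t, |G o s t| ≤ C := by
    have hle : ∀ o s t, |G o s t| ≤ ∑ o, ∑ s, ∑ t, |G o s t| := fun o s t =>
      calc |G o s t| ≤ ∑ t, |G o s t| :=
            Finset.single_le_sum (f := fun t => |G o s t|) (fun _ _ => abs_nonneg _)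
              (Finset.mem_univ t)
        _ ≤ ∑ s, ∑ t, |G o s t| :=
            Finset.single_le_sum (f := fun s => ∑ t, |G o s t|)
              (fun _ _ => Finset.sum_nonneg fun _ _ => abs_nonneg _) (Finset.mem_univ s)
        _ ≤ _ := Finset.single_le_sum (f := fun o => ∑ s, ∑ t, |G o s t|)
              (fun _ _ => Finset.sum_nonneg fun _ _ => Finset.sum_nonneg fun _ _ => abs_nonneg _)
              (Finset.mem_univ o)
    exact ⟨_, hle⟩
  set k : ℝ := Nat.cast (Fintype.card (∀ o, F o))
  obtain ⟨δ, δ0, hδ⟩ : ∃ δ : ℝ, 0 < δ ∧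
      ENNReal.ofReal (2 * C) * (2 * ENNReal.ofReal (k * δ)) ^ (1 / 2 : ℝ) ≤ ε / 3 := by
    have ht : Tendsto (fun δ : ℝ =>
        ENNReal.ofReal (2 * C) * (2 * ENNReal.ofReal (k * δ)) ^ (1 / 2 : ℝ)) (𝓝 0) (𝓝 0) := by
      have hb : Tendsto (fun δ : ℝ => 2 * ENNReal.ofReal (k * δ)) (𝓝 0) (𝓝 0) := by
        have := ENNReal.Tendsto.const_mul (a := 2) ((ENNReal.continuous_ofReal.comp
          (continuous_const_mul k)).tendsto 0) (Or.inr (by norm_num))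
        simpa using this
      have := ENNReal.Tendsto.const_mul (a := ENNReal.ofReal (2 * C))
        (((ENNReal.continuous_rpow_const (y := 1 / 2)).tendsto 0).comp hb)
        (Or.inr ENNReal.ofReal_ne_top)
      simpa using this
    have hev := (ht.eventually_le_const (pos_iff_ne_zero.2 h3)).filter_mono
      (nhdsWithin_le_nhds (s := Set.Ioi 0))
    obtain ⟨δ, h1, h2⟩ := (hev.and self_mem_nhdsWithin).exists
    exact ⟨δ, h2, h1⟩
  -- The joint partition has product boxes as cells, so one coupling serves all coordinates `o`
  -- simultaneously.
  set Q : (∀ o, (Z o).carrier) → ∀ o, F o := fun x o => q o (x o)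
  have hpre : ∀ s, Q ⁻¹' {s} = Set.univ.pi fun o => q o ⁻¹' {s o} := fun s => by
    ext x
    simp [Q, funext_iff]
  have hQ : ∀ s, MeasurableSet (Q ⁻¹' {s}) := fun s => by
    rw [hpre]
    exact MeasurableSet.univ_pi fun o => hq o _
  have hcells : ∀ᶠ n in atTop, ∀ s, (γ' : Measure (∀ o, (Z o).carrier)) (Q ⁻¹' {s}) ≤
      (γ n : Measure (∀ o, (Z o).carrier)) (Q ⁻¹' {s}) + ENNReal.ofReal δ := by
    refine eventually_all.2 fun s => ?_
    rw [hpre]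
    exact eventually_measure_pi_le hγ h (fun o => hq o _) (by simpa using δ0)
  filter_upwards [hcells] with n hn
  obtain ⟨π, hπ, hπ1, hπ2, hπE⟩ := exists_coupling_of_fibers hQ
    (γ n : Measure (∀ o, (Z o).carrier)) γ' δ0.le fun s => by
      have := ENNReal.toReal_mono (by finiteness) (hn s)
      rwa [ENNReal.toReal_add (by finiteness) (by finiteness), ENNReal.toReal_ofReal δ0.le]
        at this
  refine ⟨π, hπ, hπ1, hπ2, fun o => ?_⟩
  have m1 : Measurable fun p : (∀ o, (Z o).carrier) × ∀ o, (Z o).carrier => p.1 o := by fun_prop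
  have m2 : Measurable fun p : (∀ o, (Z o).carrier) × ∀ o, (Z o).carrier => p.2 o := by fun_prop
  have e1 : π.map (fun p => p.1 o) = (Z o).ξ := by
    rw [← hγ n o, ← hπ1, Measure.map_map (measurable_pi_apply o) measurable_fst]; rfl
  have e2 : π.map (fun p => p.2 o) = (Z o).ξ := by
    rw [← hγ' o, ← hπ2, Measure.map_map (measurable_pi_apply o) measurable_snd]; rfl
  have hfm : IsStepKernel (f o) := ⟨F o, hF o, q o, G o, hq o, hG o⟩
  have approx : ∀ {k : ((∀ o, (Z o).carrier) × ∀ o, (Z o).carrier) → (Z o).carrier},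
      Measurable k → π.map k = (Z o).ξ →
      AEStronglyMeasurable (fun p : ((∀ o, (Z o).carrier) × ∀ o, (Z o).carrier) ×
        ((∀ o, (Z o).carrier) × ∀ o, (Z o).carrier) =>
          (Z o).g (k p.1) (k p.2) - f o (k p.1, k p.2)) (π.prod π) ∧
      eLpNorm (fun p : ((∀ o, (Z o).carrier) × ∀ o, (Z o).carrier) ×
        ((∀ o, (Z o).carrier) × ∀ o, (Z o).carrier) =>
          (Z o).g (k p.1) (k p.2) - f o (k p.1, k p.2)) 2 (π.prod π) ≤ ε / 3 := by
    intro k hk hkξ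
    have hmp := measurePreserving_prodMap hk hkξ
    have hmeas := (Z o).memLp.aestronglyMeasurable.sub hfm.measurable.aestronglyMeasurable
    exact ⟨hmeas.comp_measurePreserving hmp,
      (eLpNorm_comp_measurePreserving hmeas hmp).trans_le (hfε o)⟩
  obtain ⟨a1, b1⟩ := approx m1 e1
  obtain ⟨a2, b2⟩ := approx m2 e2
  set D : ((∀ o, (Z o).carrier) × ∀ o, (Z o).carrier) ×
        ((∀ o, (Z o).carrier) × ∀ o, (Z o).carrier) → ℝ :=
    fun p => f o (p.1.1 o, p.2.1 o) - f o (p.1.2 o, p.2.2 o)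
  have hD : Measurable D :=
    (hfm.measurable.comp ((m1.comp measurable_fst).prodMk (m1.comp measurable_snd))).sub
      (hfm.measurable.comp ((m2.comp measurable_fst).prodMk (m2.comp measurable_snd)))
  have hDε : eLpNorm D 2 (π.prod π) ≤ ε / 3 := by
    have := eLpNorm_step_sub_le (q := Q) (G := fun s t => G o (s o) (t o)) (C := C)
      (fun s t => hC o _ _) π
    have hDe : D = fun p => G o (Q p.1.1 o) (Q p.2.1 o) - G o (Q p.1.2 o) (Q p.2.2 o) := by
      ext p
      simp [D, hG, Q]
    rw [hDe]
    refine this.trans (le_trans ?_ hδ)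
    gcongr
  calc _ = eLpNorm (((fun p : ((∀ o, (Z o).carrier) × ∀ o, (Z o).carrier) ×
        ((∀ o, (Z o).carrier) × ∀ o, (Z o).carrier) =>
          (Z o).g (p.1.1 o) (p.2.1 o) - f o (p.1.1 o, p.2.1 o)) + D) -
          fun p => (Z o).g (p.1.2 o) (p.2.2 o) - f o (p.1.2 o, p.2.2 o)) 2 (π.prod π) := by
        congr 1
        ext p
        simp only [D, Pi.add_apply, Pi.sub_apply]
        ring
    _ ≤ ε / 3 + ε / 3 + ε / 3 := by
        refine (eLpNorm_sub_le (a1.add hD.aestronglyMeasurable) a2 (by norm_num)).trans ?_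
        exact add_le_add ((eLpNorm_add_le a1 hD.aestronglyMeasurable (by norm_num)).trans
          (add_le_add b1 hDε)) b2
    _ = ε := ENNReal.add_thirds ε

end GMSpace

/-! ### Norm estimates in `L²` -/

theorem toReal_eLpNorm_sub_le_add {A : Type*} [MeasurableSpace A] {α : Measure A} {f g h : A → ℝ}
    (hf : MemLp f 2 α) (hg : MemLp g 2 α) (hh : MemLp h 2 α) :
    (eLpNorm (f - h) 2 α).toReal ≤ (eLpNorm (f - g) 2 α).toReal + (eLpNorm (g - h) 2 α).toReal := by
  rw [← ENNReal.toReal_add (hf.sub hg).eLpNorm_ne_top (hg.sub hh).eLpNorm_ne_top]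
  refine ENNReal.toReal_mono
    (ENNReal.add_ne_top.2 ⟨(hf.sub hg).eLpNorm_ne_top, (hg.sub hh).eLpNorm_ne_top⟩) ?_
  simpa using eLpNorm_add_le (hf.sub hg).aestronglyMeasurable (hg.sub hh).aestronglyMeasurable
    (p := 2) (by norm_num)

theorem toReal_eLpNorm_two_sq {A : Type*} [MeasurableSpace A] {α : Measure A} {f : A → ℝ}
    (hf : MemLp f 2 α) : (eLpNorm f 2 α).toReal ^ 2 = ∫ x, f x ^ 2 ∂α := by
  rw [hf.eLpNorm_eq_integral_rpow_norm (by norm_num) (by norm_num)]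
  have h0 : 0 ≤ ∫ x, f x ^ 2 ∂α := integral_nonneg fun x => sq_nonneg _
  simp only [ENNReal.toReal_ofNat, Real.rpow_ofNat, Real.norm_eq_abs, sq_abs]
  rw [ENNReal.toReal_ofReal (by positivity), ← Real.rpow_natCast, ← Real.rpow_mul h0]
  norm_num

/-! ### Descent of the barycenter functional -/

namespace GMSpace

variable {N : ℕ}

/-- Mean spaces are close if their gauges are close in every coordinate along a coupling. -/
theorem gw_meanSpace_le {X X' : Fin N → GMSpace.{u}} {ρ : Fin N → ℝ}
    (hρ : ρ ∈ stdSimplex ℝ (Fin N)) {μ : Measure (∀ i, (X i).carrier)}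
    {μ' : Measure (∀ i, (X' i).carrier)} (hμ : μ ∈ multiPlans X) (hμ' : μ' ∈ multiPlans X')
    {A : Type*} [MeasurableSpace A] {α : Measure A} [IsProbabilityMeasure α]
    {a : A → ∀ i, (X i).carrier} {b : A → ∀ i, (X' i).carrier} (ha : Measurable a)
    (hb : Measurable b) (haμ : α.map a = μ) (hbμ : α.map b = μ') {ε : ENNReal} (hε : ε ≠ ⊤)
    (h : ∀ i, eLpNorm (fun p : A × A => (X i).g (a p.1 i) (a p.2 i) -
      (X' i).g (b p.1 i) (b p.2 i)) 2 (α.prod α) ≤ ε) :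
    gw (meanSpace X ρ μ hμ) (meanSpace X' ρ μ' hμ') ≤ ε.toReal := by
  obtain ⟨h1, h2⟩ := gwFun_map (meanSpace X ρ μ hμ) (meanSpace X' ρ μ' hμ') (α := α) ha hb haμ hbμ
  refine (gw_le _ _ h1).trans ?_
  rw [h2]
  refine ENNReal.toReal_mono hε ?_
  have hmX : ∀ i, MemLp (fun p : A × A => (X i).g (a p.1 i) (a p.2 i)) 2 (α.prod α) := fun i =>
    (X i).memLp_pullback (f := fun x => a x i) ((measurable_pi_apply i).comp ha) (by
      rw [← hμ.2 i, ← haμ, Measure.map_map (measurable_pi_apply i) ha]; rfl)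
  have hmX' : ∀ i, MemLp (fun p : A × A => (X' i).g (b p.1 i) (b p.2 i)) 2 (α.prod α) := fun i =>
    (X' i).memLp_pullback (f := fun x => b x i) ((measurable_pi_apply i).comp hb) (by
      rw [← hμ'.2 i, ← hbμ, Measure.map_map (measurable_pi_apply i) hb]; rfl)
  have hm := fun i => (hmX i).sub (hmX' i)
  calc _ = eLpNorm (∑ i, ρ i • fun p : A × A => (X i).g (a p.1 i) (a p.2 i) -
        (X' i).g (b p.1 i) (b p.2 i)) 2 (α.prod α) := by
        congr 1
        ext p
        simp [meanSpace, Finset.sum_apply, mul_sub, Finset.sum_sub_distrib]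
    _ ≤ ∑ i, eLpNorm (ρ i • fun p : A × A => (X i).g (a p.1 i) (a p.2 i) -
        (X' i).g (b p.1 i) (b p.2 i)) 2 (α.prod α) :=
        eLpNorm_sum_le (fun i _ => (hm i).aestronglyMeasurable.const_smul (ρ i)) (by norm_num)
    _ ≤ ∑ i, ENNReal.ofReal (ρ i) * ε := by
        refine Finset.sum_le_sum fun i _ => ?_
        rw [eLpNorm_const_smul, Real.enorm_of_nonneg (hρ.1 i)]
        gcongr
        exact h i
    _ = ε := by
        rw [← Finset.sum_mul, ← ENNReal.ofReal_sum_of_nonneg fun i _ => hρ.1 i, hρ.2]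
        simp

/-- The barycenter functional decreases along the relaxed tangential barycenter map. -/
theorem sq_dist_add_le_of_mem_relaxedTB {ρ : Fin N → ℝ} (hρ : ρ ∈ stdSimplex ℝ (Fin N))
    {𝔛 : Fin N → GM.{u}} {𝔜 ℨ : GM.{u}} (h : ℨ ∈ relaxedTB ρ 𝔛 𝔜) :
    dist 𝔜 ℨ ^ 2 + ∑ i, ρ i * dist ℨ (𝔛 i) ^ 2 ≤ ∑ i, ρ i * dist 𝔜 (𝔛 i) ^ 2 := by
  obtain ⟨X, Y, hX, rfl, μ, hμ, rfl⟩ := h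
  obtain ⟨π, hπ, γ, ⟨hγ, hγπ⟩, hγμ⟩ := id hμ
  have hμ' := optMeltings_subset Y X hμ
  -- The `Y`-marginal of `γ` is only visible through some `π i`. The alternative `N = 0` contradicts
  -- weights summing to 1.
  have eY : γ.map Prod.fst = Y.ξ ∨ N = 0 := by
    rcases Nat.eq_zero_or_pos N with h | h
    · exact Or.inr h
    · left
      have hm : Measurable fun p : Y.carrier × (∀ i, (X i).carrier) => (p.1, p.2 ⟨0, h⟩) := by
        fun_prop
      rw [← (hπ ⟨0, h⟩).1.2.1, ← hγπ ⟨0, h⟩, Measure.map_map measurable_fst hm]; rfl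
  rcases eY with eY | rfl
  swap
  · simpa using hρ.2
  have eX : ∀ i, γ.map (fun p => p.2 i) = (X i).ξ := fun i => by
    rw [← hμ'.2 i, ← hγμ, Measure.map_map (measurable_pi_apply i) measurable_snd]; rfl
  have mX : ∀ i, Measurable fun p : Y.carrier × (∀ i, (X i).carrier) => p.2 i := fun i => by
    fun_prop
  obtain ⟨hM1, hM2⟩ := gwFun_map Y (meanSpace X ρ μ hμ') (α := γ) measurable_fst measurable_snd
    eY hγμ
  have hMX := fun i => gwFun_map (meanSpace X ρ μ hμ') (X i) (α := γ) measurable_snd (mX i)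
    hγμ (eX i)
  have hYX := fun i => (gwFun_map Y (X i) (α := γ) measurable_fst (mX i) eY (eX i)).2
  have LY := Y.memLp_pullback measurable_fst eY
  have LX := fun i => (X i).memLp_pullback (mX i) (eX i)
  have LM : MemLp (fun p : (Y.carrier × (∀ i, (X i).carrier)) × (Y.carrier × ∀ i, (X i).carrier) =>
      ∑ i, ρ i * (X i).g (p.1.2 i) (p.2.2 i)) 2 (γ.prod γ) :=
    (meanSpace X ρ μ hμ').memLp_pullback (α := γ) measurable_snd hγμ
  have b1 : dist Y.toGM (meanSpace X ρ μ hμ').toGM ^ 2 ≤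
      ∫ p, (Y.g p.1.1 p.2.1 - ∑ i, ρ i * (X i).g (p.1.2 i) (p.2.2 i)) ^ 2 ∂(γ.prod γ) := by
    rw [dist_toGM]
    refine (pow_le_pow_left₀ (gw_nonneg _ _) (gw_le _ _ hM1) 2).trans (le_of_eq ?_)
    rw [hM2]
    exact toReal_eLpNorm_two_sq (LY.sub LM)
  have b2 : ∀ i, dist (meanSpace X ρ μ hμ').toGM (𝔛 i) ^ 2 ≤
      ∫ p, ((∑ i, ρ i * (X i).g (p.1.2 i) (p.2.2 i)) - (X i).g (p.1.2 i) (p.2.2 i)) ^ 2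
        ∂(γ.prod γ) := fun i => by
    rw [← hX i, dist_toGM]
    refine (pow_le_pow_left₀ (gw_nonneg _ _) (gw_le _ _ (hMX i).1) 2).trans (le_of_eq ?_)
    rw [(hMX i).2]
    exact toReal_eLpNorm_two_sq (LM.sub (LX i))
  -- Optimality of `π i` enters here as an equality; `b1` and `b2` only need admissible plans.
  have b3 : ∀ i, dist Y.toGM (𝔛 i) ^ 2 =
      ∫ p, (Y.g p.1.1 p.2.1 - (X i).g (p.1.2 i) (p.2.2 i)) ^ 2 ∂(γ.prod γ) := fun i => by
    have := hYX i
    rw [hγπ i] at this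
    rw [← hX i, dist_toGM, ← (hπ i).2, this]
    exact toReal_eLpNorm_two_sq (LY.sub (LX i))
  have i1 := (LY.sub LM).integrable_sq
  have i2 := fun i => ((LM.sub (LX i)).integrable_sq).const_mul (ρ i)
  have i3 := fun i => ((LY.sub (LX i)).integrable_sq).const_mul (ρ i)
  simp only [Pi.sub_apply] at i1 i2 i3
  simp_rw [b3]
  refine (add_le_add b1 (Finset.sum_le_sum fun i _ =>
    mul_le_mul_of_nonneg_left (b2 i) (hρ.1 i))).trans (le_of_eq ?_)
  simp_rw [← integral_const_mul]
  rw [← integral_finsetSum _ fun i _ => i2 i, ← integral_finsetSum _ fun i _ => i3 i]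
  refine (integral_add i1 (integrable_finsetSum _ fun i _ => i2 i)).symm.trans ?_
  refine integral_congr_ae (.of_forall fun p => ?_)
  dsimp only
  set y := Y.g p.1.1 p.2.1
  set x : Fin N → ℝ := fun i => (X i).g (p.1.2 i) (p.2.2 i)
  change (y - ∑ i, ρ i * x i) ^ 2 + ∑ i, ρ i * ((∑ i, ρ i * x i) - x i) ^ 2 =
    ∑ i, ρ i * (y - x i) ^ 2
  set m := ∑ i, ρ i * x i with hm
  -- Variance decomposition around the mean `m`: after summation the correction terms collapse to
  -- `(y - m) ^ 2`.
  have e : ∀ i, ρ i * (y - x i) ^ 2 = ρ i * (m - x i) ^ 2 +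
      ((y ^ 2 - m ^ 2) * ρ i - 2 * (y - m) * (ρ i * x i)) := fun i => by ring
  simp_rw [e, Finset.sum_add_distrib, Finset.sum_sub_distrib, ← Finset.mul_sum]
  rw [hρ.2, ← hm]
  ring

/-- Successive iterates of the relaxed tangential barycenter map become close. -/
theorem tendsto_dist_succ_of_mem_relaxedTB {ρ : Fin N → ℝ} (hρ : ρ ∈ stdSimplex ℝ (Fin N))
    {𝔛 : Fin N → GM.{u}} {𝔜 : ℕ → GM.{u}} (h : ∀ n, 𝔜 (n + 1) ∈ relaxedTB ρ 𝔛 (𝔜 n)) :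
    Tendsto (fun n => dist (𝔜 n) (𝔜 (n + 1))) atTop (𝓝 0) := by
  set B : ℕ → ℝ := fun n => ∑ i, ρ i * dist (𝔜 n) (𝔛 i) ^ 2
  have hB : ∀ n, dist (𝔜 n) (𝔜 (n + 1)) ^ 2 ≤ B n - B (n + 1) := fun n => by
    have := sq_dist_add_le_of_mem_relaxedTB hρ (h n)
    linarith
  have hanti : Antitone B := antitone_nat_of_succ_le fun n => by
    have := (sq_nonneg _).trans (hB n)
    linarith
  have hlim := tendsto_atTop_ciInf hanti ⟨0, by
    rintro _ ⟨n, rfl⟩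
    exact Finset.sum_nonneg fun i _ => mul_nonneg (hρ.1 i) (sq_nonneg _)⟩
  have hdiff := hlim.sub (hlim.comp (tendsto_add_atTop_nat 1))
  rw [sub_self] at hdiff
  have hsq : Tendsto (fun n => dist (𝔜 n) (𝔜 (n + 1)) ^ 2) atTop (𝓝 0) :=
    squeeze_zero (fun n => sq_nonneg _) hB hdiff
  have := (Real.continuous_sqrt.tendsto 0).comp hsq
  simpa [Function.comp_def, Real.sqrt_sq dist_nonneg] using this

end GMSpace

/-! ### Transfer to fixed representatives, compactness and closed graph -/

namespace GMSpace

variable {N : ℕ}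

/-- The family `𝕐, 𝕏₁, …, 𝕏_N`. -/
def consFamily (Y : GMSpace.{u}) (X : Fin N → GMSpace.{u}) : Option (Fin N) → GMSpace.{u} :=
  fun o => o.elim Y X

/-- The `L²`-distance of the gauges of `𝕐` and `𝕏ᵢ` under a plan of `𝕐, 𝕏₁, …, 𝕏_N`. -/
noncomputable def gaugeDist (Y : GMSpace.{u}) (X : Fin N → GMSpace.{u})
    (Γ : Measure (∀ o, (consFamily Y X o).carrier)) (i : Fin N) : ℝ :=
  (eLpNorm (fun p : (∀ o, (consFamily Y X o).carrier) × (∀ o, (consFamily Y X o).carrier) =>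
    (consFamily Y X none).g (p.1 none) (p.2 none) -
      (consFamily Y X (some i)).g (p.1 (some i)) (p.2 (some i))) 2 (Γ.prod Γ)).toReal

theorem exists_plan_lt (X Y : GMSpace.{u}) {ε : ℝ} (hε : 0 < ε) :
    ∃ π ∈ plans X Y, gwFun X Y π < gw X Y + ε := by
  obtain ⟨_, ⟨π, hπ, rfl⟩, h⟩ := exists_lt_of_csInf_lt (nonempty_gwFun X Y)
    (lt_add_of_pos_right (sInf (gwFun X Y '' plans X Y)) hε)
  exact ⟨π, hπ, h⟩

theorem measurable_some_coordinates (Z : Option (Fin N) → GMSpace.{u}) :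
    Measurable fun (x : ∀ o, (Z o).carrier) (i : Fin N) => x (some i) :=
  measurable_pi_iff.2 fun i => measurable_pi_apply (some i)

theorem map_some_mem_multiPlans {Y : GMSpace.{u}} {X : Fin N → GMSpace.{u}}
    {Γ : Measure (∀ o, (consFamily Y X o).carrier)} [IsProbabilityMeasure Γ]
    (hΓ : ∀ o, Γ.map (fun x => x o) = (consFamily Y X o).ξ) :
    Γ.map (fun x i => x (some i)) ∈ multiPlans X := by
  have hm := measurable_some_coordinates (consFamily Y X)
  refine ⟨Measure.isProbabilityMeasure_map hm.aemeasurable, fun i => ?_⟩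
  exact (Measure.map_map (measurable_pi_apply i) hm).trans (hΓ (some i))

/-- Gauge distances change little along a coupling of plans for which the gauges are close. -/
theorem gaugeDist_le_add {Y Y' : GMSpace.{u}} {X X' : Fin N → GMSpace.{u}}
    {Γ : Measure (∀ o, (consFamily Y X o).carrier)}
    {Γ' : Measure (∀ o, (consFamily Y' X' o).carrier)}
    (hΓ : ∀ o, Γ.map (fun x => x o) = (consFamily Y X o).ξ)
    (hΓ' : ∀ o, Γ'.map (fun x => x o) = (consFamily Y' X' o).ξ)
    {π : Measure ((∀ o, (consFamily Y X o).carrier) × ∀ o, (consFamily Y' X' o).carrier)}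
    [IsProbabilityMeasure π] (h1 : π.map Prod.fst = Γ) (h2 : π.map Prod.snd = Γ')
    (c : Option (Fin N) → ℝ)
    (hc : ∀ o, (eLpNorm (fun p : ((∀ o, (consFamily Y X o).carrier) ×
      ∀ o, (consFamily Y' X' o).carrier) × ((∀ o, (consFamily Y X o).carrier) ×
      ∀ o, (consFamily Y' X' o).carrier) => (consFamily Y X o).g (p.1.1 o) (p.2.1 o) -
        (consFamily Y' X' o).g (p.1.2 o) (p.2.2 o)) 2 (π.prod π)).toReal ≤ c o) (i : Fin N) :
    gaugeDist Y' X' Γ' i ≤ c none + gaugeDist Y X Γ i + c (some i) := by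
  have : IsProbabilityMeasure Γ := h1 ▸
    Measure.isProbabilityMeasure_map measurable_fst.aemeasurable
  have : IsProbabilityMeasure Γ' := h2 ▸
    Measure.isProbabilityMeasure_map measurable_snd.aemeasurable
  have L : ∀ o, MemLp (fun p : ((∀ o, (consFamily Y X o).carrier) ×
      ∀ o, (consFamily Y' X' o).carrier) × ((∀ o, (consFamily Y X o).carrier) ×
      ∀ o, (consFamily Y' X' o).carrier) => (consFamily Y X o).g (p.1.1 o) (p.2.1 o)) 2
      (π.prod π) := fun o =>
    (consFamily Y X o).memLp_pullback (α := π)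
      ((measurable_pi_apply o).comp measurable_fst) (by
      rw [← hΓ o, ← h1, Measure.map_map (measurable_pi_apply o) measurable_fst])
  have L' : ∀ o, MemLp (fun p : ((∀ o, (consFamily Y X o).carrier) ×
      ∀ o, (consFamily Y' X' o).carrier) × ((∀ o, (consFamily Y X o).carrier) ×
      ∀ o, (consFamily Y' X' o).carrier) => (consFamily Y' X' o).g (p.1.2 o) (p.2.2 o)) 2
      (π.prod π) := fun o =>
    (consFamily Y' X' o).memLp_pullback (α := π)
      ((measurable_pi_apply o).comp measurable_snd) (by
      rw [← hΓ' o, ← h2, Measure.map_map (measurable_pi_apply o) measurable_snd])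
  have mp1 := measurePreserving_prodMap measurable_fst h1
  have mp2 := measurePreserving_prodMap measurable_snd h2
  have LΓ : ∀ o, MemLp (fun p : (∀ o, (consFamily Y X o).carrier) ×
      (∀ o, (consFamily Y X o).carrier) => (consFamily Y X o).g (p.1 o) (p.2 o)) 2
      (Γ.prod Γ) := fun o => (consFamily Y X o).memLp_pullback (measurable_pi_apply o) (hΓ o)
  have LΓ' : ∀ o, MemLp (fun p : (∀ o, (consFamily Y' X' o).carrier) ×
      (∀ o, (consFamily Y' X' o).carrier) => (consFamily Y' X' o).g (p.1 o) (p.2 o)) 2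
      (Γ'.prod Γ') := fun o =>
    (consFamily Y' X' o).memLp_pullback (measurable_pi_apply o) (hΓ' o)
  have e1 := eLpNorm_comp_measurePreserving (p := 2)
    ((LΓ none).sub (LΓ (some i))).aestronglyMeasurable mp1
  have e2 := eLpNorm_comp_measurePreserving (p := 2)
    ((LΓ' none).sub (LΓ' (some i))).aestronglyMeasurable mp2
  -- Triangle inequality along the chain of gauges `Y'`, `Y`, `X i`, `X' i`, all pulled back to `π`.
  have t1 := toReal_eLpNorm_sub_le_add (L' none) (L none) (L' (some i))
  have t2 := toReal_eLpNorm_sub_le_add (L none) (L (some i)) (L' (some i))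
  have c1 := hc none
  have c2 := hc (some i)
  have d1 : gaugeDist Y X Γ i = _ := congrArg ENNReal.toReal e1.symm
  have d2 : gaugeDist Y' X' Γ' i = _ := congrArg ENNReal.toReal e2.symm
  rw [d1, d2]
  refine t1.trans ((add_le_add ((congrArg ENNReal.toReal (eLpNorm_sub_comm _ _ _ _)).trans_le c1)
    (t2.trans (add_le_add le_rfl c2))).trans_eq ?_)
  exact (add_assoc _ _ _).symm

/-- Every element of `T̃B_ρ(𝔜)` is, up to an arbitrarily small error, the mean space of a plan of
prescribed representatives. -/
theorem exists_plan_of_mem_relaxedTB {ρ : Fin N → ℝ} (hρ : ρ ∈ stdSimplex ℝ (Fin N))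
    {𝔛 : Fin N → GM.{u}} {𝔜 ℨ : GM.{u}} (h : ℨ ∈ relaxedTB ρ 𝔛 𝔜) {X : Fin N → GMSpace.{u}}
    (hX : ∀ i, (X i).toGM = 𝔛 i) (Y : GMSpace.{u}) {ε : ℝ} (hε : 0 < ε) :
    ∃ Γ : Measure (∀ o, (consFamily Y X o).carrier), ∃ (_ : IsProbabilityMeasure Γ)
      (hΓ : ∀ o, Γ.map (fun x => x o) = (consFamily Y X o).ξ),
      (∀ i, gaugeDist Y X Γ i ≤ dist 𝔜 Y.toGM + dist 𝔜 (𝔛 i) + 2 * ε) ∧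
      dist ℨ (meanSpace X ρ _ (map_some_mem_multiPlans hΓ)).toGM ≤ ε := by
  obtain ⟨X', Y', hX', rfl, μ, hμ, rfl⟩ := h
  obtain ⟨π, hπ, γ, ⟨hγ, hγπ⟩, hγμ⟩ := id hμ
  have hμ' := optMeltings_subset Y' X' hμ
  have hN : Nonempty (Fin N) := by
    rcases isEmpty_or_nonempty (Fin N) with h | h
    · exact absurd hρ.2 (by simp)
    · exact h
  let j : Y'.carrier × (∀ i, (X' i).carrier) → ∀ o, (consFamily Y' X' o).carrier :=
    fun p o => match o with
      | none => p.1
      | some i => p.2 i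
  have hj : Measurable j := by
    refine measurable_pi_iff.2 ?_
    rintro (_ | i)
    · exact measurable_fst
    · exact (measurable_pi_apply i).comp measurable_snd
  have hmi : ∀ i, Measurable fun p : Y'.carrier × (∀ i, (X' i).carrier) => (p.1, p.2 i) :=
    fun i => by fun_prop
  have hγj : IsProbabilityMeasure (γ.map j) := Measure.isProbabilityMeasure_map hj.aemeasurable
  have hmarg : ∀ o, (γ.map j).map (fun x => x o) = (consFamily Y' X' o).ξ := by
    intro o
    rw [Measure.map_map (measurable_pi_apply o) hj]
    rcases o with _ | i
    · obtain ⟨i⟩ := hN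
      refine Eq.trans ?_ (hπ i).1.2.1
      rw [← hγπ i, Measure.map_map measurable_fst (hmi i)]
      rfl
    · refine Eq.trans ?_ (hπ i).1.2.2
      rw [← hγπ i, Measure.map_map measurable_snd (hmi i)]
      rfl
  -- Plans within `ε` of the infimum suffice, so attainment is not needed, even between
  -- representatives of the same class.
  choose τ hτ hτε using fun o => exists_plan_lt (consFamily Y' X' o) (consFamily Y X o) hε
  have hτp : ∀ o, IsProbabilityMeasure (τ o) := fun o => (hτ o).1
  obtain ⟨Γ₀, hΓ₀, hΓ₁, hΓτ⟩ := exists_gluing_pi (γ.map j) τ fun o =>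
    (hτ o).2.1.trans (hmarg o).symm
  have hΓp : IsProbabilityMeasure (Γ₀.map Prod.snd) :=
    Measure.isProbabilityMeasure_map measurable_snd.aemeasurable
  have m1 : ∀ o, Measurable fun p : (∀ o, (consFamily Y' X' o).carrier) ×
      (∀ o, (consFamily Y X o).carrier) => p.1 o := fun o => by fun_prop
  have m2 : ∀ o, Measurable fun p : (∀ o, (consFamily Y' X' o).carrier) ×
      (∀ o, (consFamily Y X o).carrier) => p.2 o := fun o => by fun_prop
  have k1 : ∀ o, Γ₀.map (fun p => p.1 o) = (consFamily Y' X' o).ξ := fun o => by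
    rw [← (hτ o).2.1, ← hΓτ o, Measure.map_map measurable_fst ((m1 o).prodMk (m2 o))]; rfl
  have k2 : ∀ o, Γ₀.map (fun p => p.2 o) = (consFamily Y X o).ξ := fun o => by
    rw [← (hτ o).2.2, ← hΓτ o, Measure.map_map measurable_snd ((m1 o).prodMk (m2 o))]; rfl
  have hΓ : ∀ o, (Γ₀.map Prod.snd).map (fun x => x o) = (consFamily Y X o).ξ := fun o =>
    (Measure.map_map (measurable_pi_apply o) measurable_snd).trans (k2 o)
  have hcost : ∀ o, (eLpNorm (fun p : ((∀ o, (consFamily Y' X' o).carrier) ×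
      ∀ o, (consFamily Y X o).carrier) × ((∀ o, (consFamily Y' X' o).carrier) ×
      ∀ o, (consFamily Y X o).carrier) => (consFamily Y' X' o).g (p.1.1 o) (p.2.1 o) -
        (consFamily Y X o).g (p.1.2 o) (p.2.2 o)) 2 (Γ₀.prod Γ₀)).toReal ≤
      gw (consFamily Y' X' o) (consFamily Y X o) + ε := fun o => by
    have := (gwFun_map (consFamily Y' X' o) (consFamily Y X o) (m1 o) (m2 o) (k1 o) (k2 o)).2
    rw [hΓτ o] at this
    exact this ▸ (hτε o).le
  have hzero : ∀ i, gw (X' i) (X i) = 0 := fun i =>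
    (toGM_eq_iff _ _).1 ((hX' i).trans (hX i).symm)
  refine ⟨Γ₀.map Prod.snd, hΓp, hΓ, fun i => ?_, ?_⟩
  -- The two `ε` come from the transfers `Y'` to `Y` and `X' i` to `X i`; the latter has distance 0.
  · have hle := gaugeDist_le_add hmarg hΓ hΓ₁ rfl _ hcost i
    have hopt : gaugeDist Y' X' (γ.map j) i = dist Y'.toGM (𝔛 i) := by
      rw [← hX' i, dist_toGM, ← (hπ i).2, ← hγπ i]
      refine Eq.trans ?_ (congrArg (gwFun Y' (X' i)) (Measure.map_map
        ((measurable_pi_apply none).prodMk (measurable_pi_apply (some i))) hj))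
      exact (gwFun_map Y' (X' i) (α := γ.map j) (measurable_pi_apply none)
        (measurable_pi_apply (some i)) (hmarg none) (hmarg (some i))).2.symm
    rw [hopt] at hle
    have h1 : gw (consFamily Y' X' none) (consFamily Y X none) = dist Y'.toGM Y.toGM := rfl
    have h2 : gw (consFamily Y' X' (some i)) (consFamily Y X (some i)) = 0 := hzero i
    rw [h1, h2] at hle
    linarith
  · have hs' := measurable_some_coordinates (consFamily Y' X')
    have hs := measurable_some_coordinates (consFamily Y X)
    refine (gw_meanSpace_le hρ hμ' (map_some_mem_multiPlans hΓ) (α := Γ₀)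
      (hs'.comp measurable_fst) (hs.comp measurable_snd) ?_ ?_ (ε := ENNReal.ofReal ε)
      ENNReal.ofReal_ne_top fun i => ?_).trans_eq (ENNReal.toReal_ofReal hε.le)
    · exact (Measure.map_map hs' measurable_fst).symm.trans
        ((congrArg (Measure.map _) hΓ₁).trans ((Measure.map_map hs' hj).trans hγμ))
    · exact (Measure.map_map hs measurable_snd).symm
    · have hc := hcost (some i)
      have h2 : gw (consFamily Y' X' (some i)) (consFamily Y X (some i)) = 0 := hzero i
      rw [h2, zero_add] at hc
      refine (ENNReal.le_ofReal_iff_toReal_le ?_ hε.le).2 hc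
      exact (((X' i).memLp_pullback (m1 (some i)) (k1 (some i))).sub
        ((X i).memLp_pullback (m2 (some i)) (k2 (some i)))).eLpNorm_ne_top

/-- The relaxed tangential barycenter map has relatively compact range and closed graph. -/
theorem exists_subseq_tendsto_relaxedTB {ρ : Fin N → ℝ} (hρ : ρ ∈ stdSimplex ℝ (Fin N))
    {𝔛 : Fin N → GM.{u}} {𝔜 ℨ : ℕ → GM.{u}} (h : ∀ n, ℨ n ∈ relaxedTB ρ 𝔛 (𝔜 n))
    (𝔜' : GM.{u}) :
    ∃ ψ : ℕ → ℕ, StrictMono ψ ∧ ∃ ℨ' : GM.{u}, Tendsto (ℨ ∘ ψ) atTop (𝓝 ℨ') ∧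
      (Tendsto 𝔜 atTop (𝓝 𝔜') → ℨ' ∈ relaxedTB ρ 𝔛 𝔜') := by
  obtain ⟨Y, rfl⟩ : ∃ Y : GMSpace.{u}, Y.toGM = 𝔜' := SeparationQuotient.surjective_mk 𝔜'
  have hrep : ∀ i, ∃ X : GMSpace.{u}, X.toGM = 𝔛 i := fun i =>
    SeparationQuotient.surjective_mk (𝔛 i)
  choose X hX using hrep
  -- `Y` is only a reference space here: `𝔜 n` may be far from it, which weakens the bound on gauge
  -- distances but not the one on mean spaces.
  choose Γ hΓp hΓ hΓd hΓm using fun n =>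
    exists_plan_of_mem_relaxedTB hρ (h n) hX Y (Nat.one_div_pos_of_nat (α := ℝ) (n := n))
  let P : ℕ → ProbabilityMeasure (∀ o, (consFamily Y X o).carrier) := fun n => ⟨Γ n, hΓp n⟩
  obtain ⟨Γ', hΓ', ψ, hψ, hlim⟩ := exists_subseq_tendsto_of_marginals P hΓ
  have hcoup := fun (ε : ENNReal) (hε : ε ≠ 0) =>
    eventually_exists_coupling_of_tendsto (consFamily Y X) (γ := P ∘ ψ)
      (fun n => hΓ (ψ n)) hΓ' hlim hε
  have hψε : Tendsto (fun n => 1 / ((ψ n : ℝ) + 1)) atTop (𝓝 0) :=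
    tendsto_one_div_add_atTop_nhds_zero_nat.comp hψ.tendsto_atTop
  have hs := measurable_some_coordinates (consFamily Y X)
  have hμ' := map_some_mem_multiPlans hΓ'
  refine ⟨ψ, hψ, (meanSpace X ρ _ hμ').toGM, ?_, fun h𝔜 => ?_⟩
  · rw [Metric.tendsto_nhds]
    intro ε hε
    filter_upwards [hcoup (ENNReal.ofReal (ε / 2)) (by simpa using hε),
      hψε.eventually_lt_const (half_pos hε)] with n ⟨π, hπ, hπ1, hπ2, hπε⟩ hn
    have h1 := gw_meanSpace_le hρ (map_some_mem_multiPlans (hΓ (ψ n))) hμ' (α := π)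
      (hs.comp measurable_fst) (hs.comp measurable_snd)
      ((Measure.map_map hs measurable_fst).symm.trans (congrArg (Measure.map _) hπ1))
      ((Measure.map_map hs measurable_snd).symm.trans (congrArg (Measure.map _) hπ2))
      ENNReal.ofReal_ne_top fun i => hπε (some i)
    rw [ENNReal.toReal_ofReal (half_pos hε).le, ← dist_toGM] at h1
    calc _ ≤ _ := dist_triangle _ _ _
      _ < ε / 2 + ε / 2 := add_lt_add_of_lt_of_le ((hΓm (ψ n)).trans_lt hn) h1
      _ = ε := add_halves ε
  -- Once `𝔜 n` tends to the class of `Y`, the bounds `hΓd` tend to the optimal value, so the limit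
  -- plan is optimal for every `i`.
  · have hle : ∀ i, gaugeDist Y X Γ' i ≤ dist Y.toGM (𝔛 i) := fun i => by
      refine le_of_forall_pos_le_add fun ε hε => ?_
      have hd : Tendsto (fun n => dist (𝔜 (ψ n)) Y.toGM + dist (𝔜 (ψ n)) (𝔛 i) +
          2 * (1 / ((ψ n : ℝ) + 1))) atTop (𝓝 (dist Y.toGM (𝔛 i))) := by
        have h𝔜ψ := h𝔜.comp hψ.tendsto_atTop
        have := ((h𝔜ψ.dist (tendsto_const_nhds (x := Y.toGM))).add
          (h𝔜ψ.dist (tendsto_const_nhds (x := 𝔛 i)))).add (hψε.const_mul 2)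
        simpa using this
      -- Two thirds of `ε` for the gauges at `none` and `some i`, one third for the limit of the
      -- bounds.
      obtain ⟨n, ⟨π, hπ, hπ1, hπ2, hπε⟩, hn⟩ := ((hcoup (ENNReal.ofReal (ε / 3))
        (by simpa using hε)).and (hd.eventually_lt_const
          (lt_add_of_pos_right _ (by positivity : 0 < ε / 3)))).exists
      have h1 := gaugeDist_le_add (hΓ (ψ n)) hΓ' hπ1 hπ2 (fun _ => ε / 3)
        (fun o => ENNReal.toReal_le_of_le_ofReal (by positivity) (hπε o)) i
      have h2 := hΓd (ψ n) i
      linarith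
    have m0 : Measurable fun x : ∀ o, (consFamily Y X o).carrier => x none :=
      measurable_pi_apply none
    have hplan := fun i => gwFun_map Y (X i) (α := Γ') m0
      (measurable_pi_apply (some i)) (hΓ' none) (hΓ' (some i))
    have hm : Measurable fun x : ∀ o, (consFamily Y X o).carrier =>
        (x none, fun i => x (some i)) := m0.prodMk hs
    have hopt : (Γ' : Measure (∀ o, (consFamily Y X o).carrier)).map (fun x i => x (some i)) ∈
        optMeltings Y X := by
      refine ⟨_, fun i => ⟨(hplan i).1, le_antisymm ?_ (gw_le _ _ (hplan i).1)⟩,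
        Measure.map (fun x => (x none, fun i => x (some i)))
          (Γ' : Measure (∀ o, (consFamily Y X o).carrier)),
        ⟨Measure.isProbabilityMeasure_map hm.aemeasurable, fun i => ?_⟩, ?_⟩
      · rw [← dist_toGM, hX i]
        exact (hplan i).2.trans_le (hle i)
      · exact Measure.map_map (measurable_fst.prodMk
          ((measurable_pi_apply i).comp measurable_snd)) hm
      · exact Measure.map_map measurable_snd hm
    exact ⟨X, Y, hX, rfl, _, hopt, rfl⟩

end GMSpace

/-! ### Conclusion -/

theorem theorem6p3 {N : ℕ} (𝔛 : Fin N → GM.{u}) (ρ : Fin N → ℝ) (hρ : ρ ∈ stdSimplex ℝ (Fin N))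
    (𝔜 : ℕ → GM.{u}) (h𝔜 : ∀ n, 𝔜 (n + 1) ∈ relaxedTB ρ 𝔛 (𝔜 n))
    (φ : ℕ → ℕ) (hφ : StrictMono φ) :
    ∃ ψ : ℕ → ℕ, StrictMono ψ ∧ ∃ 𝔜lim : GM.{u},
      Tendsto (fun l => 𝔜 (φ (ψ l))) atTop (𝓝 𝔜lim) ∧ 𝔜lim ∈ relaxedTB ρ 𝔛 𝔜lim := by
  have hd := GMSpace.tendsto_dist_succ_of_mem_relaxedTB hρ h𝔜
  -- Only compactness is used, applied to the successors `𝔜 (φ l + 1)`; the reference point `𝔜 0` is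
  -- arbitrary.
  obtain ⟨ψ, hψ, 𝔜lim, hlim, -⟩ := GMSpace.exists_subseq_tendsto_relaxedTB hρ
    (fun l => h𝔜 (φ l)) (𝔜 0)
  have hlim' : Tendsto (fun l => 𝔜 (φ (ψ l))) atTop (𝓝 𝔜lim) :=
    (tendsto_iff_of_dist (hd.comp (hφ.comp hψ).tendsto_atTop)).2 hlim
  -- Now the closed graph is used: arguments and successors converge to the same point.
  obtain ⟨χ, hχ, ℨ, hℨ, hmem⟩ := GMSpace.exists_subseq_tendsto_relaxedTB hρ
    (fun l => h𝔜 (φ (ψ l))) 𝔜lim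
  have : ℨ = 𝔜lim := tendsto_nhds_unique hℨ (hlim.comp hχ.tendsto_atTop)
  exact ⟨ψ, hψ, 𝔜lim, hlim', this ▸ hmem hlim'⟩
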